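/- \textbf{Setting.} Let $m\in\mathbb N$, $m\ge 1$. For $k\in\mathbb Z$ let $A(k),B(k)\in\mathbb C^{2m\times 2m}$ have $m\times m$ blocks $A_{i,j}(k),B_{i,j}(k)$, and let $\rho(k)\in\mathbb C^{m\times m}$. For sequences $y=(y_1,y_2)^\top$ on $\mathbb Z$, where $y_1,y_2$ have $m$ rows, put $$(\mathcal S_\rho y)(k)=\begin{pmatrix}\rho(k)y_2(k+1)\\ \rho(k-1)y_1(k-1)\end{pmatrix},\qquad \widehat y(k)=\begin{pmatrix}y_1(k)\\ y_2(k+1)\end{pmatrix}.$$ Assume that for all $k\in\mathbb Z$: $A(k)\ge 0$, $B(k)=B(k)^*$, $\rho(k)>0$, and $\zeta A_{1,2}(k)+B_{1,2}(k)$ is invertible for every $\zeta\in\mathbb C$. Assume also that for every $\zeta\in\mathbb C$, every solution $\psi:\mathbb Z\to\mathbb C^{2m}$, $\psi\not\equiv0$, of $\mathcal S_\rho\psi=(\zeta A+B)\psi$, and all integers $c<d$, one has $\sum_{k=c}^d\psi(k)^*A(k)\psi(k)>0$. Let $J=\begin{pmatrix}0&I_m\\-I_m&0\end{pmatrix}$,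 $J_\rho(k)=\begin{pmatrix}0&\rho(k)\\-\rho(k)&0\end{pmatrix}$, $I_\rho(k)=\begin{pmatrix}\rho(k)&0\\0&\rho(k)\end{pmatrix}$. Fix $k_0\in\mathbb Z$ and $\alpha\in\mathbb C^{m\times 2m}$ with $\alpha\alpha^*=I_m$ and $\alpha J\alpha^*=0$, and put $\widetilde\alpha=\alpha I_\rho(k_0)^{1/2}$. For $\zeta\in\mathbb C$ let $\Psi(\zeta,\cdot)$ be the $2m\times 2m$ matrix solution of $\mathcal S_\rho\Psi=(\zeta A+B)\Psi$ on $\mathbb Z$ with $\widehat\Psi(\zeta,k_0)=I_\rho(k_0)^{-1}(\widetilde\alpha^*\ \ J\widetilde\alpha^*)$. For $M\in\mathbb C^{m\times m}$ let $U_M(\zeta,k)=\Psi(\zeta,k)\begin{pmatrix}I_m\\M\end{pmatrix}$. For $\zeta\in\mathbb C\setminus\mathbb R$ and $\ell\ne k_0$ let $$E_\ell(M)=\sigma\,\widehat U_M(\zeta,\ell)^*\big(-iJ_\rho(\ell)\big)\widehat U_M(\zeta,\ell),\qquad \sigma=\frac{(\ell-k_0)\,\mathrm{Im}\,\zeta}{|(\ell-k_0)\,\mathrm{Im}\,\zeta|},$$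 let $\mathcal D(\zeta,\ell)=\{M\in\mathbb C^{m\times m}: E_\ell(M)\le 0\}$ be the Weyl disk, and let $\mathcal D_+(\zeta)=\bigcap_{\ell>k_0}\mathcal D(\zeta,\ell)$ and $\mathcal D_-(\zeta)=\bigcap_{\ell<k_0}\mathcal D(\zeta,\ell)$ be the limiting disks. The system is in the limit point case at $\pm\infty$ if $\mathcal D_\pm$ is a singleton, and in the limit circle case at $\pm\infty$ if $\mathcal D_\pm$ has nonempty interior. Let $\ell^2_A(\mathbb Z)$ be the set of $f:\mathbb Z\to\mathbb C^{2m}$ with $\|f\|^2=\sum_{k\in\mathbb Z}f(k)^*A(k)f(k)<\infty$. \textbf{Theorem.} Let $\mathrm{Im}\,z>0$, and suppose that, for this $z$ (and for $k_0,\alpha$), the limit point or the limit circle case holds at $\infty$, and the limit point or the limit circle case holds at $-\infty$. Let $M_\pm\in\partial\mathcal D_\pm(z)$, the topological boundary in $\mathbb C^{m\times m}$. Then $M_\pm^*\in\partial\mathcal D_\pm(\bar z)$. Put $$U_\pm(z,\cdot)=U_{M_\pm}(z,\cdot),\qquad U_\pm(\bar z,\cdot)=U_{M_\pm^*}(\bar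 z,\cdot),\qquad U_\pm=\begin{pmatrix}u_{\pm,1}\\u_{\pm,2}\end{pmatrix}.$$ Then $M_--M_+$ is invertible, and $\omega(z):=[M_--M_+]^{-1}$ satisfies $$\omega(z)=\pm\big(\widehat U_\mp(\bar z,k_0)^*J_\rho(k_0)\widehat U_\pm(z,k_0)\big)^{-1}.$$ Define $$K(z,k,\ell)=\begin{cases}U_+(z,k)\,\omega(z)\,U_-(\bar z,\ell)^*,&k>\ell,\\[1mm] \begin{pmatrix}u_{+,1}(z,k)\omega(z)u_{-,1}(\bar z,k)^*&u_{+,1}(z,k)\omega(z)u_{-,2}(\bar z,k)^*\\u_{-,2}(z,k)\omega(z)u_{+,1}(\bar z,k)^*&u_{-,2}(z,k)\omega(z)u_{+,2}(\bar z,k)^*\end{pmatrix},&k=\ell,\\[1mm] U_-(z,k)\,\omega(z)\,U_+(\bar z,\ell)^*,&k<\ell.\end{cases}$$ Then $\sum_{\ell\in\mathbb Z}K(z,k,\ell)A(\ell)K(z,k,\ell)^*$ converges for every $k\in\mathbb Z$. Moreover, for every $f\in\ell^2_A(\mathbb Z)$ the series $$y(z,k)=\sum_{\ell\in\mathbb Z}K(z,k,\ell)A(\ell)f(\ell),\qquad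 k\in\mathbb Z,$$ converges, $\mathcal S_\rho y=(zA+B)y+Af$ on $\mathbb Z$, $y(z,\cdot)\in\ell^2_A(\mathbb Z)$, and $\|y(z,\cdot)\|\le|\mathrm{Im}\,z|^{-1}\|f\|$. -/

import Mathlib

open Matrix Topology
open scoped ComplexOrder MatrixOrder

/-- The coefficients `A(k)`, `B(k)` (of size `2m × 2m`, in `m × m` blocks) and `ρ(k)` (of size
`m × m`), `k ∈ ℤ`, of a discrete Hamiltonian system `𝒮_ρ Ψ = (z A + B) Ψ`. -/
structure HamiltonianSystem (m : ℕ) where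
  A : ℤ → Matrix (Fin m ⊕ Fin m) (Fin m ⊕ Fin m) ℂ
  B : ℤ → Matrix (Fin m ⊕ Fin m) (Fin m ⊕ Fin m) ℂ
  ρ : ℤ → Matrix (Fin m) (Fin m) ℂ

noncomputable section

namespace HamiltonianSystem

variable {m : ℕ}

/-- The matrix `z A(k) + B(k)`. -/
def coeff (H : HamiltonianSystem m) (z : ℂ) (k : ℤ) :
    Matrix (Fin m ⊕ Fin m) (Fin m ⊕ Fin m) ℂ :=
  z • H.A k + H.B k

/-- The difference expression `𝒮_ρ = [0, ρ S⁺; ρ⁻ S⁻, 0]`, that is,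
`(𝒮_ρ y)(k) = (ρ(k) y₂(k+1), ρ(k-1) y₁(k-1))`. -/
def diffExpr (H : HamiltonianSystem m) (y : ℤ → Fin m ⊕ Fin m → ℂ) (k : ℤ) :
    Fin m ⊕ Fin m → ℂ :=
  Sum.elim (H.ρ k *ᵥ fun i => y (k + 1) (Sum.inr i))
    (H.ρ (k - 1) *ᵥ fun i => y (k - 1) (Sum.inl i))

/-- `ψ` solves the homogeneous system `𝒮_ρ ψ = (z A + B) ψ` on `ℤ`. -/
def IsSolution (H : HamiltonianSystem m) (z : ℂ) (ψ : ℤ → Fin m ⊕ Fin m → ℂ) : Prop :=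
  ∀ k, H.diffExpr ψ k = H.coeff z k *ᵥ ψ k

/-- The number `φ(k)^* A(k) φ(k)`, which is real and nonnegative when `A(k) ≥ 0`. -/
def density (H : HamiltonianSystem m) (φ : ℤ → Fin m ⊕ Fin m → ℂ) (k : ℤ) : ℝ :=
  (star (φ k) ⬝ᵥ (H.A k *ᵥ φ k)).re

/-- The standing assumptions on the coefficients, on the whole line `ℤ`. -/
structure IsAdmissible (H : HamiltonianSystem m) : Prop where
  A_nonneg : ∀ k, (H.A k).PosSemidef
  B_selfAdjoint : ∀ k, (H.B k).IsHermitian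
  ρ_pos : ∀ k, (H.ρ k).PosDef
  invertible : ∀ (k : ℤ) (z : ℂ), IsUnit (z • (H.A k).toBlocks₁₂ + (H.B k).toBlocks₁₂)
  definite : ∀ (z : ℂ) (ψ : ℤ → Fin m ⊕ Fin m → ℂ), H.IsSolution z ψ → ψ ≠ 0 →
    ∀ c d : ℤ, c < d → 0 < ∑ k ∈ Finset.Icc c d, H.density ψ k

/-- `f ∈ ℓ²_A(ℤ)`. -/
def MemL2A (H : HamiltonianSystem m) (f : ℤ → Fin m ⊕ Fin m → ℂ) : Prop :=
  Summable (H.density f)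

/-- The (semi)norm of `ℓ²_A(ℤ)`. -/
def normA (H : HamiltonianSystem m) (f : ℤ → Fin m ⊕ Fin m → ℂ) : ℝ :=
  Real.sqrt (∑' k, H.density f k)

/-- The matrix `J = [0, I; -I, 0]`. -/
def J (m : ℕ) : Matrix (Fin m ⊕ Fin m) (Fin m ⊕ Fin m) ℂ :=
  fromBlocks 0 1 (-1) 0

/-- The matrix `J_ρ(k) = [0, ρ(k); -ρ(k), 0]`. -/
def Jρ (H : HamiltonianSystem m) (k : ℤ) : Matrix (Fin m ⊕ Fin m) (Fin m ⊕ Fin m) ℂ :=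
  fromBlocks 0 (H.ρ k) (-H.ρ k) 0

/-- The matrix `I_ρ(k) = [ρ(k), 0; 0, ρ(k)]`. -/
def Iρ (H : HamiltonianSystem m) (k : ℤ) : Matrix (Fin m ⊕ Fin m) (Fin m ⊕ Fin m) ℂ :=
  fromBlocks (H.ρ k) 0 0 (H.ρ k)

/-- The positive definite square root `I_ρ(k)^{1/2}`. -/
def sqrtIρ (H : HamiltonianSystem m) (k : ℤ) : Matrix (Fin m ⊕ Fin m) (Fin m ⊕ Fin m) ℂ :=
  fromBlocks (CFC.sqrt (H.ρ k)) 0 0 (CFC.sqrt (H.ρ k))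

/-- Boundary data `α ∈ ℂ^{m × 2m}` with `α α^* = I` and `α J α^* = 0`. -/
def IsBoundaryData (α : Matrix (Fin m) (Fin m ⊕ Fin m) ℂ) : Prop :=
  α * αᴴ = 1 ∧ α * J m * αᴴ = 0

/-- `Ŷ(k) = (y₁(k), y₂(k+1))` for `Y = (y₁, y₂)`. -/
def hat {r : Type*} (Y : ℤ → Matrix (Fin m ⊕ Fin m) r ℂ) (k : ℤ) :
    Matrix (Fin m ⊕ Fin m) r ℂ :=
  fromRows (Y k).toRows₁ (Y (k + 1)).toRows₂

/-- The initial value `I_ρ(k₀)⁻¹ (α̃^*  J α̃^*)`, where `α̃ = α I_ρ(k₀)^{1/2}`. -/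
def initialValue (H : HamiltonianSystem m) (k₀ : ℤ) (α : Matrix (Fin m) (Fin m ⊕ Fin m) ℂ) :
    Matrix (Fin m ⊕ Fin m) (Fin m ⊕ Fin m) ℂ :=
  (H.Iρ k₀)⁻¹ * fromCols (α * H.sqrtIρ k₀)ᴴ (J m * (α * H.sqrtIρ k₀)ᴴ)

/-- The transfer matrix, which maps `Ψ̂(k-1) = (ψ₁(k-1), ψ₂(k))` to `Ψ̂(k) = (ψ₁(k), ψ₂(k+1))` for
every solution `Ψ`. With `a, b, c', c` the blocks of `z A(k) + B(k)`, the first factor applied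
solves `ρ(k-1) ψ₁(k-1) = c' ψ₁(k) + c ψ₂(k)` for `ψ₁(k)`, and the second one solves
`ρ(k) ψ₂(k+1) = a ψ₁(k) + b ψ₂(k)` for `ψ₂(k+1)`. -/
def transfer (H : HamiltonianSystem m) (z : ℂ) (k : ℤ) :
    Matrix (Fin m ⊕ Fin m) (Fin m ⊕ Fin m) ℂ :=
  fromBlocks 1 0 ((H.ρ k)⁻¹ * (H.coeff z k).toBlocks₁₁) ((H.ρ k)⁻¹ * (H.coeff z k).toBlocks₁₂) *
  fromBlocks ((H.coeff z k).toBlocks₂₁⁻¹ * H.ρ (k - 1))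
    (-((H.coeff z k).toBlocks₂₁⁻¹ * (H.coeff z k).toBlocks₂₂)) 0 1

/-- `Ψ̂(k₀ + n)` for the fundamental system `Ψ`. -/
def hatForward (H : HamiltonianSystem m) (z : ℂ) (k₀ : ℤ)
    (α : Matrix (Fin m) (Fin m ⊕ Fin m) ℂ) : ℕ → Matrix (Fin m ⊕ Fin m) (Fin m ⊕ Fin m) ℂ
  | 0 => H.initialValue k₀ α
  | n + 1 => H.transfer z (k₀ + n + 1) * hatForward H z k₀ α n

/-- `Ψ̂(k₀ - n)` for the fundamental system `Ψ`. -/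
def hatBackward (H : HamiltonianSystem m) (z : ℂ) (k₀ : ℤ)
    (α : Matrix (Fin m) (Fin m ⊕ Fin m) ℂ) : ℕ → Matrix (Fin m ⊕ Fin m) (Fin m ⊕ Fin m) ℂ
  | 0 => H.initialValue k₀ α
  | n + 1 => (H.transfer z (k₀ - n))⁻¹ * hatBackward H z k₀ α n

/-- `Ψ̂(k)` for the fundamental system `Ψ`. -/
def hatFundamental (H : HamiltonianSystem m) (z : ℂ) (k₀ : ℤ)
    (α : Matrix (Fin m) (Fin m ⊕ Fin m) ℂ) (k : ℤ) :
    Matrix (Fin m ⊕ Fin m) (Fin m ⊕ Fin m) ℂ :=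
  if k₀ ≤ k then H.hatForward z k₀ α (k - k₀).toNat else H.hatBackward z k₀ α (k₀ - k).toNat

/-- The normalized fundamental system `Ψ(z, k, k₀, α̃) = (Θ  Φ)`: the `2m × 2m` matrix solution of
the Hamiltonian system with `Ψ̂(z, k₀) = I_ρ(k₀)⁻¹ (α̃^*  J α̃^*)`
(see `hat_fundamental` and `isSolution_fundamental` below). -/
def fundamental (H : HamiltonianSystem m) (z : ℂ) (k₀ : ℤ)
    (α : Matrix (Fin m) (Fin m ⊕ Fin m) ℂ) (k : ℤ) :
    Matrix (Fin m ⊕ Fin m) (Fin m ⊕ Fin m) ℂ :=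
  fromRows (H.hatFundamental z k₀ α k).toRows₁ (H.hatFundamental z k₀ α (k - 1)).toRows₂

/-- `U(z, k) = Ψ(z, k) (I; M)`. -/
def weylSolution (H : HamiltonianSystem m) (z : ℂ) (k₀ : ℤ)
    (α : Matrix (Fin m) (Fin m ⊕ Fin m) ℂ) (M : Matrix (Fin m) (Fin m) ℂ) (k : ℤ) :
    Matrix (Fin m ⊕ Fin m) (Fin m) ℂ :=
  H.fundamental z k₀ α k * fromRows 1 M

/-- The sign `σ(ℓ, k, z)` of `(ℓ - k) Im z`. -/
def σ (ℓ k : ℤ) (z : ℂ) : ℝ :=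
  (((ℓ - k : ℤ) : ℝ) * z.im) / |((ℓ - k : ℤ) : ℝ) * z.im|

/-- The matrix-valued function `E_ℓ(M) = σ(ℓ, k₀, z) Û(z, ℓ)^* (-i J_ρ(ℓ)) Û(z, ℓ)`. With this
sign, `2 σ Im M = -E_ℓ(M) + 2 |Im z| ∑ U(z, s)^* A(s) U(z, s)`, the sum being over
`min{k₀, ℓ} < s ≤ max{k₀, ℓ}`. -/
def weylE (H : HamiltonianSystem m) (z : ℂ) (k₀ : ℤ) (α : Matrix (Fin m) (Fin m ⊕ Fin m) ℂ)
    (ℓ : ℤ) (M : Matrix (Fin m) (Fin m) ℂ) : Matrix (Fin m) (Fin m) ℂ :=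
  (σ ℓ k₀ z : ℂ) •
    ((hat (H.weylSolution z k₀ α M) ℓ)ᴴ * (-Complex.I • H.Jρ ℓ) *
      hat (H.weylSolution z k₀ α M) ℓ)

/-- The Weyl disk `𝒟(z, ℓ, k₀, α̃)`, `ℓ ≠ k₀`. -/
def weylDisk (H : HamiltonianSystem m) (z : ℂ) (k₀ : ℤ) (α : Matrix (Fin m) (Fin m ⊕ Fin m) ℂ)
    (ℓ : ℤ) : Set (Matrix (Fin m) (Fin m) ℂ) :=
  {M | H.weylE z k₀ α ℓ M ≤ 0}

/-- The limiting disk `𝒟₊(z, k₀, α̃)` at `∞`. -/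
def limitingDiskPlus (H : HamiltonianSystem m) (z : ℂ) (k₀ : ℤ)
    (α : Matrix (Fin m) (Fin m ⊕ Fin m) ℂ) : Set (Matrix (Fin m) (Fin m) ℂ) :=
  ⋂ ℓ : ℤ, ⋂ _ : k₀ < ℓ, H.weylDisk z k₀ α ℓ

/-- The limiting disk `𝒟₋(z, k₀, α̃)` at `-∞`. -/
def limitingDiskMinus (H : HamiltonianSystem m) (z : ℂ) (k₀ : ℤ)
    (α : Matrix (Fin m) (Fin m ⊕ Fin m) ℂ) : Set (Matrix (Fin m) (Fin m) ℂ) :=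
  ⋂ ℓ : ℤ, ⋂ _ : ℓ < k₀, H.weylDisk z k₀ α ℓ

/-- A limiting disk is of limit point type when it is a singleton. -/
def IsLimitPoint (D : Set (Matrix (Fin m) (Fin m) ℂ)) : Prop :=
  ∃ M, D = {M}

/-- A limiting disk is of limit circle type when it has nonempty interior. -/
def IsLimitCircle (D : Set (Matrix (Fin m) (Fin m) ℂ)) : Prop :=
  (interior D).Nonempty

/-- `ω = [M₋ - M₊]⁻¹`. -/
def omega (Mp Mm : Matrix (Fin m) (Fin m) ℂ) : Matrix (Fin m) (Fin m) ℂ :=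
  (Mm - Mp)⁻¹

/-- The whole-line Green's matrix `K(z, k, ℓ)` built from `M₊(z) = Mp` and `M₋(z) = Mm`, with
`M_±(z̄) = M_±(z)^*`. -/
def greenMatrix (H : HamiltonianSystem m) (z : ℂ) (k₀ : ℤ)
    (α : Matrix (Fin m) (Fin m ⊕ Fin m) ℂ) (Mp Mm : Matrix (Fin m) (Fin m) ℂ) (k ℓ : ℤ) :
    Matrix (Fin m ⊕ Fin m) (Fin m ⊕ Fin m) ℂ :=
  let Up := H.weylSolution z k₀ α Mp
  let Um := H.weylSolution z k₀ α Mm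
  let Vp := H.weylSolution (star z) k₀ α Mpᴴ
  let Vm := H.weylSolution (star z) k₀ α Mmᴴ
  let ω := omega Mp Mm
  if ℓ < k then Up k * ω * (Vm ℓ)ᴴ
  else if k < ℓ then Um k * ω * (Vp ℓ)ᴴ
  else fromBlocks
    ((Up k).toRows₁ * ω * (Vm k).toRows₁ᴴ) ((Up k).toRows₁ * ω * (Vm k).toRows₂ᴴ)
    ((Um k).toRows₂ * ω * (Vp k).toRows₁ᴴ) ((Um k).toRows₂ * ω * (Vp k).toRows₂ᴴ)

/-- `y(z, k) = ∑_ℓ K(z, k, ℓ) A(ℓ) f(ℓ)`. -/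
def greenSolution (H : HamiltonianSystem m) (z : ℂ) (k₀ : ℤ)
    (α : Matrix (Fin m) (Fin m ⊕ Fin m) ℂ) (Mp Mm : Matrix (Fin m) (Fin m) ℂ)
    (f : ℤ → Fin m ⊕ Fin m → ℂ) (k : ℤ) : Fin m ⊕ Fin m → ℂ :=
  ∑' ℓ : ℤ, (H.greenMatrix z k₀ α Mp Mm k ℓ * H.A ℓ) *ᵥ f ℓ

/-! The fundamental system has the initial value and solves the system. -/

theorem hat_fundamental_eq (H : HamiltonianSystem m) (z : ℂ) (k₀ : ℤ)
    (α : Matrix (Fin m) (Fin m ⊕ Fin m) ℂ) (k : ℤ) :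
    hat (H.fundamental z k₀ α) k = H.hatFundamental z k₀ α k := by
  simp [hat, fundamental]

theorem hat_fundamental (H : HamiltonianSystem m) (z : ℂ) (k₀ : ℤ)
    (α : Matrix (Fin m) (Fin m ⊕ Fin m) ℂ) :
    hat (H.fundamental z k₀ α) k₀ = H.initialValue k₀ α := by
  rw [hat_fundamental_eq]
  simp [hatFundamental, hatForward]

theorem isUnit_coeff₂₁ (H : HamiltonianSystem m) (hH : H.IsAdmissible) (z : ℂ) (k : ℤ) :
    IsUnit (H.coeff z k).toBlocks₂₁.det := by
  have h := hH.invertible k (star z)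
  rw [Matrix.isUnit_iff_isUnit_det] at h
  have e : (H.coeff z k).toBlocks₂₁ =
      (star z • (H.A k).toBlocks₁₂ + (H.B k).toBlocks₁₂)ᴴ := by
    ext i j
    have h1 := (hH.A_nonneg k).isHermitian.apply (Sum.inr i) (Sum.inl j)
    have h2 := (hH.B_selfAdjoint k).apply (Sum.inr i) (Sum.inl j)
    simp [coeff, toBlocks₂₁, toBlocks₁₂, ← h1, ← h2]
  rw [e, det_conjTranspose]
  exact h.star

theorem isUnit_coeff₁₂ (H : HamiltonianSystem m) (hH : H.IsAdmissible) (z : ℂ) (k : ℤ) :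
    IsUnit (H.coeff z k).toBlocks₁₂.det := by
  have h := hH.invertible k z
  rw [Matrix.isUnit_iff_isUnit_det] at h
  exact h

theorem isUnit_ρ (H : HamiltonianSystem m) (hH : H.IsAdmissible) (k : ℤ) :
    IsUnit (H.ρ k).det :=
  (Matrix.isUnit_iff_isUnit_det _).1 (hH.ρ_pos k).isUnit

theorem isUnit_transfer (H : HamiltonianSystem m) (hH : H.IsAdmissible) (z : ℂ) (k : ℤ) :
    IsUnit (H.transfer z k).det := by
  simp only [transfer, det_mul, det_fromBlocks_zero₁₂, det_fromBlocks_zero₂₁, det_one, one_mul,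
    mul_one, det_nonsing_inv]
  exact ((isUnit_ringInverse.2 (H.isUnit_ρ hH k)).mul (H.isUnit_coeff₁₂ hH z k)).mul
    ((isUnit_ringInverse.2 (H.isUnit_coeff₂₁ hH z k)).mul (H.isUnit_ρ hH (k - 1)))

theorem hatFundamental_step (H : HamiltonianSystem m) (hH : H.IsAdmissible) (z : ℂ) (k₀ : ℤ)
    (α : Matrix (Fin m) (Fin m ⊕ Fin m) ℂ) (k : ℤ) :
    H.hatFundamental z k₀ α k = H.transfer z k * H.hatFundamental z k₀ α (k - 1) := by
  unfold hatFundamental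
  rcases lt_trichotomy k₀ k with h | h | h
  · obtain ⟨n, hn⟩ := Int.eq_ofNat_of_zero_le (show 0 ≤ k - 1 - k₀ by omega)
    have hk : k = k₀ + n + 1 := by omega
    subst hk
    have e1 : (k₀ + (n : ℤ) + 1 - k₀).toNat = n + 1 := by omega
    have e2 : (k₀ + (n : ℤ) + 1 - 1 - k₀).toNat = n := by omega
    rw [if_pos (by omega), if_pos (by omega), e1, e2, hatForward]
  · subst h
    have e1 : (k₀ - (k₀ - 1)).toNat = 0 + 1 := by omega
    rw [if_pos le_rfl, if_neg (by omega), e1, hatBackward, sub_self, Int.toNat_zero,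
      hatForward, hatBackward, Nat.cast_zero, sub_zero, ← Matrix.mul_assoc,
      Matrix.mul_nonsing_inv _ (H.isUnit_transfer hH z k₀), Matrix.one_mul]
  · obtain ⟨n, hn⟩ := Int.eq_ofNat_of_zero_le (show 0 ≤ k₀ - k by omega)
    have hk : k = k₀ - n := by omega
    subst hk
    have e1 : (k₀ - (k₀ - (n : ℤ))).toNat = n := by omega
    have e2 : (k₀ - (k₀ - (n : ℤ) - 1)).toNat = n + 1 := by omega
    rw [if_neg (by omega), if_neg (by omega), e1, e2, hatBackward, ← Matrix.mul_assoc,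
      Matrix.mul_nonsing_inv _ (H.isUnit_transfer hH z _), Matrix.one_mul]

theorem transfer_spec (H : HamiltonianSystem m) (hH : H.IsAdmissible) (z : ℂ) (k : ℤ)
    {X Y : Matrix (Fin m ⊕ Fin m) (Fin m ⊕ Fin m) ℂ} (h : X = H.transfer z k * Y) :
    fromRows (H.ρ k * X.toRows₂) (H.ρ (k - 1) * Y.toRows₁) =
      H.coeff z k * fromRows X.toRows₁ Y.toRows₂ := by
  have hY := (fromRows_toRows Y).symm
  have h' : X = fromRows
      ((H.coeff z k).toBlocks₂₁⁻¹ * H.ρ (k - 1) * Y.toRows₁ +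
        -((H.coeff z k).toBlocks₂₁⁻¹ * (H.coeff z k).toBlocks₂₂) * Y.toRows₂)
      ((H.ρ k)⁻¹ * (H.coeff z k).toBlocks₁₁ * ((H.coeff z k).toBlocks₂₁⁻¹ * H.ρ (k - 1) * Y.toRows₁ +
        -((H.coeff z k).toBlocks₂₁⁻¹ * (H.coeff z k).toBlocks₂₂) * Y.toRows₂) +
        (H.ρ k)⁻¹ * (H.coeff z k).toBlocks₁₂ * Y.toRows₂) := by
    rw [h, transfer, Matrix.mul_assoc]
    conv_lhs => rw [hY]
    rw [fromBlocks_mul_fromRows, fromBlocks_mul_fromRows]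
    simp
  have hX1 : X.toRows₁ = (H.coeff z k).toBlocks₂₁⁻¹ * H.ρ (k - 1) * Y.toRows₁ +
        -((H.coeff z k).toBlocks₂₁⁻¹ * (H.coeff z k).toBlocks₂₂) * Y.toRows₂ := by
    rw [h', toRows₁_fromRows]
  have hX2 : X.toRows₂ = (H.ρ k)⁻¹ * ((H.coeff z k).toBlocks₁₁ * X.toRows₁ +
        (H.coeff z k).toBlocks₁₂ * Y.toRows₂) := by
    rw [hX1, h', toRows₂_fromRows]
    simp only [Matrix.mul_add, Matrix.mul_assoc]
  conv_rhs => rw [← fromBlocks_toBlocks (H.coeff z k)]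
  rw [fromBlocks_mul_fromRows, hX2, ← Matrix.mul_assoc,
    Matrix.mul_nonsing_inv _ (H.isUnit_ρ hH k), Matrix.one_mul]
  congr 1
  have hu := Matrix.mul_nonsing_inv _ (H.isUnit_coeff₂₁ hH z k)
  rw [hX1, Matrix.mul_add, ← Matrix.mul_assoc, ← Matrix.mul_assoc, hu, Matrix.one_mul,
    Matrix.neg_mul, Matrix.mul_neg, ← Matrix.mul_assoc, ← Matrix.mul_assoc, hu, Matrix.one_mul]
  abel

/-- Every column of the fundamental system solves the Hamiltonian system. -/
theorem isSolution_fundamental (H : HamiltonianSystem m) (hH : H.IsAdmissible) (z : ℂ) (k₀ : ℤ)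
    (α : Matrix (Fin m) (Fin m ⊕ Fin m) ℂ) (j : Fin m ⊕ Fin m) :
    H.IsSolution z (fun k i => H.fundamental z k₀ α k i j) := by
  intro k
  have h := H.transfer_spec hH z k (H.hatFundamental_step hH z k₀ α k)
  funext i
  have hi := congrFun (congrFun h i) j
  rcases i with i | i
  · simpa [diffExpr, fundamental, Matrix.mul_apply, mulVec, dotProduct] using hi
  · simpa [diffExpr, fundamental, Matrix.mul_apply, mulVec, dotProduct] using hi

end HamiltonianSystem

end

/-! Everything rests on the form `[x,y]_k = x̂(k)^* J_ρ(k) ŷ(k)` and Lagrange's identity for its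
increments (`bracket_sub_bracket`). Since `A` and `B` are Hermitian, the form is constant in `k`
when `x` solves the system at `z̄` and `y` solves it at `z`. For a single solution at `z`, `Im
[x,x]` grows at each step by `2 Im z` times the density.

Constancy and the symplectic initial value give `Ψ̂(z̄)^* J_ρ Ψ̂(z) = -J` at every site, hence
`Û_N(z̄)^* J_ρ Û_M(z) = N^* - M` (`weylSolution_gram`), which contains both formulas for `ω`.
Membership in a Weyl disk is a sign condition on `Im [u,u]_ℓ` for `u = U_M v`; an inertia argument
carries it from `(z, M)` to `(z̄, M^*)`. The limiting disks are closed, so `M_±` lie in them. With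
the growth law this makes `U_±(z)` and `U_±(z̄)` square summable near `±∞`. A kernel vector of `M_-
- M_+` would give a nonzero solution whose `Im [u,u]` has one sign far to the left and the opposite
sign far to the right, against strict monotonicity.

The identity `U_+ ω U_-^* - U_- ω U_+^* = Ψ J Ψ^*` gives `K` the jump of a Green's matrix at `ℓ =
k`. In `ℓ`, the rows of `K` are Weyl solutions at `z̄` on both sides of `k`, so the series converge.

For the norm bound, `f` is truncated to a finite set. Far out `y` is then a Weyl solution, the
boundary brackets have favourable signs, and Lagrange's identity bounds `Im z ‖y‖²` by `-Im ∑ y^* A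
f`. Completing the square and letting the truncation grow gives the estimate. -/

namespace HamiltonianSystem

/-! ### The bracket and Lagrange's identity -/

/-- `ŷ(k) = (y₁(k), y₂(k+1))` for a sequence of vectors `y = (y₁, y₂)`. -/
def hatVec {m : ℕ} (y : ℤ → Fin m ⊕ Fin m → ℂ) (k : ℤ) : Fin m ⊕ Fin m → ℂ :=
  Sum.elim (fun i => y k (Sum.inl i)) (fun i => y (k + 1) (Sum.inr i))

/-- The sesquilinear form `x^* J_ρ(k) y`. -/
noncomputable def bracket {m : ℕ} (H : HamiltonianSystem m) (k : ℤ) (x y : Fin m ⊕ Fin m → ℂ) : ℂ :=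
  star x ⬝ᵥ (H.Jρ k *ᵥ y)

variable {m : ℕ} {H : HamiltonianSystem m}

theorem star_mulVec_dotProduct {n : Type*} [Fintype n] {P : Matrix n n ℂ} (hP : P.IsHermitian)
    (u v : n → ℂ) : star (P *ᵥ u) ⬝ᵥ v = star u ⬝ᵥ (P *ᵥ v) := by
  rw [star_mulVec, hP.eq, dotProduct_mulVec]

theorem star_star_dotProduct {n : Type*} [Fintype n] (u v : n → ℂ) :
    star (star u ⬝ᵥ v) = star v ⬝ᵥ u := by
  simp [dotProduct, mul_comm]

theorem im_star_dotProduct_mulVec {n : Type*} [Fintype n] {P : Matrix n n ℂ}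
    (hP : P.IsHermitian) (u : n → ℂ) : (star u ⬝ᵥ (P *ᵥ u)).im = 0 := by
  have h : star (star u ⬝ᵥ (P *ᵥ u)) = star u ⬝ᵥ (P *ᵥ u) := by
    rw [star_star_dotProduct, star_mulVec_dotProduct hP]
  exact Complex.conj_eq_iff_im.1 h

theorem bracket_eq (H : HamiltonianSystem m) (k : ℤ) (x y : Fin m ⊕ Fin m → ℂ) :
    H.bracket k x y = star (x ∘ Sum.inl) ⬝ᵥ (H.ρ k *ᵥ (y ∘ Sum.inr)) -
      star (x ∘ Sum.inr) ⬝ᵥ (H.ρ k *ᵥ (y ∘ Sum.inl)) := by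
  simp only [bracket, Jρ, fromBlocks_mulVec, dotProduct, Fintype.sum_sum_type, zero_mulVec, zero_add,
    add_zero, neg_mulVec, Sum.elim_inl, Sum.elim_inr, Pi.star_apply, Function.comp, Pi.neg_apply,
    mul_neg, Finset.sum_neg_distrib, sub_eq_add_neg]

theorem star_dotProduct_sum (x y : Fin m ⊕ Fin m → ℂ) :
    star x ⬝ᵥ y = star (x ∘ Sum.inl) ⬝ᵥ (y ∘ Sum.inl) + star (x ∘ Sum.inr) ⬝ᵥ (y ∘ Sum.inr) := by
  simp [dotProduct, Fintype.sum_sum_type]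

theorem star_bracket (hH : H.IsAdmissible) (k : ℤ) (x y : Fin m ⊕ Fin m → ℂ) :
    star (H.bracket k x y) = -H.bracket k y x := by
  rw [bracket_eq, bracket_eq, star_sub, star_star_dotProduct, star_star_dotProduct,
    star_mulVec_dotProduct (hH.ρ_pos k).isHermitian,
    star_mulVec_dotProduct (hH.ρ_pos k).isHermitian]
  ring

/-- Lagrange's identity. -/
theorem bracket_sub_bracket (hH : H.IsAdmissible) (x y : ℤ → Fin m ⊕ Fin m → ℂ) (k : ℤ) :
    H.bracket k (hatVec x k) (hatVec y k) - H.bracket (k - 1) (hatVec x (k - 1)) (hatVec y (k - 1)) =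
      star (x k) ⬝ᵥ H.diffExpr y k - star (H.diffExpr x k) ⬝ᵥ y k := by
  have e1 : H.diffExpr x k ∘ Sum.inl = H.ρ k *ᵥ (fun i => x (k + 1) (Sum.inr i)) := rfl
  have e2 : H.diffExpr x k ∘ Sum.inr = H.ρ (k - 1) *ᵥ (fun i => x (k - 1) (Sum.inl i)) := rfl
  have e3 : H.diffExpr y k ∘ Sum.inl = H.ρ k *ᵥ (fun i => y (k + 1) (Sum.inr i)) := rfl
  have e4 : H.diffExpr y k ∘ Sum.inr = H.ρ (k - 1) *ᵥ (fun i => y (k - 1) (Sum.inl i)) := rfl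
  have f1 (w : ℤ → Fin m ⊕ Fin m → ℂ) (j : ℤ) :
    hatVec w j ∘ Sum.inl = fun i => w j (Sum.inl i) := rfl
  have f2 (w : ℤ → Fin m ⊕ Fin m → ℂ) (j : ℤ) :
    hatVec w j ∘ Sum.inr = fun i => w (j + 1) (Sum.inr i) := rfl
  rw [star_dotProduct_sum (x k), star_dotProduct_sum (H.diffExpr x k), e1, e2, e3, e4,
    star_mulVec_dotProduct (hH.ρ_pos _).isHermitian,
    star_mulVec_dotProduct (hH.ρ_pos _).isHermitian, bracket_eq, bracket_eq]
  simp only [f1, f2, sub_add_cancel]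
  change _ = _ + star (fun i => x k (Sum.inr i)) ⬝ᵥ _ - (_ + _ ⬝ᵥ (_ *ᵥ fun i => y k (Sum.inr i)))
  change _ = star (fun i => x k (Sum.inl i)) ⬝ᵥ _ + _ - (_ ⬝ᵥ (_ *ᵥ fun i => y k (Sum.inl i)) + _)
  ring

/-- The forms `x^* A x` and `x^* B x` are real, so in Lagrange's identity only `Im z` and the source
term survive. -/
theorem im_bracket_sub (hH : H.IsAdmissible) {z : ℂ} {x f : ℤ → Fin m ⊕ Fin m → ℂ} {k : ℤ}
    (hx : H.diffExpr x k = H.coeff z k *ᵥ x k + H.A k *ᵥ f k) :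
    (H.bracket k (hatVec x k) (hatVec x k)).im -
        (H.bracket (k - 1) (hatVec x (k - 1)) (hatVec x (k - 1))).im =
      2 * z.im * H.density x k + 2 * (star (x k) ⬝ᵥ (H.A k *ᵥ f k)).im := by
  rw [← Complex.sub_im, bracket_sub_bracket hH, ← star_star_dotProduct (x k), Complex.sub_im,
    Complex.star_def, Complex.conj_im, hx, dotProduct_add, coeff, add_mulVec, smul_mulVec,
    dotProduct_add, dotProduct_smul, smul_eq_mul]
  have hA := im_star_dotProduct_mulVec (hH.A_nonneg k).isHermitian (x k)
  have hB := im_star_dotProduct_mulVec (hH.B_selfAdjoint k) (x k)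
  simp only [Complex.add_im, Complex.mul_im, hA, hB, density]
  ring

theorem im_bracket_sub_of_isSolution (hH : H.IsAdmissible) {z : ℂ} {x : ℤ → Fin m ⊕ Fin m → ℂ}
    (hx : H.IsSolution z x) (k : ℤ) :
    (H.bracket k (hatVec x k) (hatVec x k)).im -
        (H.bracket (k - 1) (hatVec x (k - 1)) (hatVec x (k - 1))).im =
      2 * z.im * H.density x k := by
  have h := im_bracket_sub hH (f := 0) (k := k) (x := x) (z := z) (by simpa using hx k)
  simpa using h

/-- Moving `z̄ A + B` across the inner product turns it into `z A + B`, so the two sides of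
Lagrange's identity cancel. -/
theorem bracket_const (hH : H.IsAdmissible) {z : ℂ} {x y : ℤ → Fin m ⊕ Fin m → ℂ}
    (hx : H.IsSolution (star z) x) (hy : H.IsSolution z y) (k : ℤ) :
    H.bracket k (hatVec x k) (hatVec y k) =
      H.bracket (k - 1) (hatVec x (k - 1)) (hatVec y (k - 1)) := by
  rw [← sub_eq_zero, bracket_sub_bracket hH, hx k, hy k, sub_eq_zero]
  simp only [coeff, add_mulVec, smul_mulVec, star_add, star_smul, star_star, add_dotProduct,
    dotProduct_add, smul_dotProduct, dotProduct_smul,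
    star_mulVec_dotProduct (hH.A_nonneg k).isHermitian,
    star_mulVec_dotProduct (hH.B_selfAdjoint k)]

theorem bracket_eq_bracket (hH : H.IsAdmissible) {z : ℂ} {x y : ℤ → Fin m ⊕ Fin m → ℂ}
    (hx : H.IsSolution (star z) x) (hy : H.IsSolution z y) (k k₀ : ℤ) :
    H.bracket k (hatVec x k) (hatVec y k) = H.bracket k₀ (hatVec x k₀) (hatVec y k₀) := by
  induction k using Int.inductionOn' (b := k₀) with
  | zero => rfl
  | succ k _ ih =>
    rw [bracket_const hH hx hy, add_sub_cancel_right, ih]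
  | pred k _ ih => rw [← bracket_const hH hx hy, ih]

/-! ### The fundamental system -/

theorem fundamental_eq (hH : H.IsAdmissible) (z : ℂ) (k₀ : ℤ)
    (α : Matrix (Fin m) (Fin m ⊕ Fin m) ℂ) (k : ℤ) :
    fromRows (H.ρ k * (H.hatFundamental z k₀ α k).toRows₂)
        (H.ρ (k - 1) * (H.hatFundamental z k₀ α (k - 1)).toRows₁) =
      H.coeff z k * H.fundamental z k₀ α k :=
  H.transfer_spec hH z k (H.hatFundamental_step hH z k₀ α k)

theorem isSolution_fundamental_mulVec (hH : H.IsAdmissible) (z : ℂ) (k₀ : ℤ)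
    (α : Matrix (Fin m) (Fin m ⊕ Fin m) ℂ) (v : Fin m ⊕ Fin m → ℂ) :
    H.IsSolution z (fun k => H.fundamental z k₀ α k *ᵥ v) := by
  intro k
  rw [mulVec_mulVec, ← fundamental_eq hH, fromRows_mulVec, ← mulVec_mulVec, ← mulVec_mulVec,
    diffExpr]
  simp only [fundamental, fromRows_mulVec, Sum.elim_inl, Sum.elim_inr, add_sub_cancel_right]

theorem hat_mulVec {r : Type*} [Fintype r] (Y : ℤ → Matrix (Fin m ⊕ Fin m) r ℂ) (v : r → ℂ) (k : ℤ) :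
    hat Y k *ᵥ v = hatVec (fun j => Y j *ᵥ v) k := by
  rw [hat, fromRows_mulVec]
  rfl

theorem sqrtIρ_mul_self (hH : H.IsAdmissible) (k : ℤ) : H.sqrtIρ k * H.sqrtIρ k = H.Iρ k := by
  have h : CFC.sqrt (H.ρ k) * CFC.sqrt (H.ρ k) = H.ρ k :=
    CFC.sqrt_mul_sqrt_self _ (hH.ρ_pos k).posSemidef.nonneg
  simp [sqrtIρ, Iρ, fromBlocks_multiply, h]

theorem conjTranspose_sqrtIρ (H : HamiltonianSystem m) (k : ℤ) : (H.sqrtIρ k)ᴴ = H.sqrtIρ k := by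
  have h : (CFC.sqrt (H.ρ k))ᴴ = CFC.sqrt (H.ρ k) :=
    (nonneg_iff_posSemidef.1 (CFC.sqrt_nonneg (H.ρ k))).isHermitian
  simp [sqrtIρ, fromBlocks_conjTranspose, h]

theorem isUnit_det_Iρ (hH : H.IsAdmissible) (k : ℤ) : IsUnit (H.Iρ k).det := by
  rw [Iρ, det_fromBlocks_zero₁₂]
  exact (H.isUnit_ρ hH k).mul (H.isUnit_ρ hH k)

theorem J_mul_J (m : ℕ) : J m * J m = -1 := by
  rw [J, fromBlocks_multiply, ← fromBlocks_one, fromBlocks_neg]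
  simp

theorem conjTranspose_J (m : ℕ) : (J m)ᴴ = -J m := by
  simp [J, fromBlocks_conjTranspose, fromBlocks_neg]

/-- With `S = I_ρ^{1/2}`, which commutes with `J`, one has `J_ρ = S J S`, and the initial value is
`S⁻¹ (α^* J α^*)`. The factors `S` cancel, and `α α^* = 1`, `α J α^* = 0`, `J² = -1` do the rest. -/
theorem initialValue_gram (hH : H.IsAdmissible) (k₀ : ℤ) {α : Matrix (Fin m) (Fin m ⊕ Fin m) ℂ}
    (hα : IsBoundaryData α) :
    (H.initialValue k₀ α)ᴴ * H.Jρ k₀ * H.initialValue k₀ α = -J m := by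
  have hSS := sqrtIρ_mul_self hH k₀
  have hS : IsUnit (H.sqrtIρ k₀).det := by
    have := isUnit_det_Iρ hH k₀
    rw [← hSS, det_mul] at this
    exact isUnit_of_mul_isUnit_left this
  have hJS : J m * H.sqrtIρ k₀ = H.sqrtIρ k₀ * J m := by
    simp [J, sqrtIρ, fromBlocks_multiply]
  have hJρ : H.Jρ k₀ = H.sqrtIρ k₀ * J m * H.sqrtIρ k₀ := by
    rw [Matrix.mul_assoc, hJS, ← Matrix.mul_assoc, hSS]
    simp [J, Iρ, Jρ, fromBlocks_multiply]
  have hinv : H.initialValue k₀ α = (H.sqrtIρ k₀)⁻¹ * fromCols αᴴ (J m * αᴴ) := by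
    rw [initialValue, conjTranspose_mul, conjTranspose_sqrtIρ, ← Matrix.mul_assoc (J m), hJS,
      Matrix.mul_assoc _ (J m), ← mul_fromCols, ← Matrix.mul_assoc, ← hSS, Matrix.mul_inv_rev,
      Matrix.nonsing_inv_mul_cancel_right _ _ hS]
  have hc : H.sqrtIρ k₀ * H.initialValue k₀ α = fromCols αᴴ (J m * αᴴ) := by
    rw [hinv, ← Matrix.mul_assoc, Matrix.mul_nonsing_inv _ hS, Matrix.one_mul]
  have hr : (H.initialValue k₀ α)ᴴ * H.sqrtIρ k₀ = fromRows α (-(α * J m)) := by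
    have := congrArg conjTranspose hc
    rw [conjTranspose_mul, conjTranspose_sqrtIρ] at this
    rw [this, conjTranspose_fromCols_eq_fromRows_conjTranspose, conjTranspose_conjTranspose,
      conjTranspose_mul, conjTranspose_conjTranspose, conjTranspose_J, Matrix.mul_neg]
  have h1 : α * J m * (J m * αᴴ) = -1 := by
    rw [Matrix.mul_assoc, ← Matrix.mul_assoc (J m), J_mul_J, Matrix.neg_mul, Matrix.one_mul,
      Matrix.mul_neg, hα.1]
  have h2 : α * J m * J m = -α := by
    rw [Matrix.mul_assoc, J_mul_J, Matrix.mul_neg, Matrix.mul_one]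
  calc _ = ((H.initialValue k₀ α)ᴴ * H.sqrtIρ k₀) * J m * (H.sqrtIρ k₀ * H.initialValue k₀ α) := by
        rw [hJρ]; simp only [Matrix.mul_assoc]
    _ = _ := by
        rw [hr, hc, fromRows_mul, fromRows_mul_fromCols, h1, hα.2, Matrix.neg_mul, h2, neg_neg,
          ← Matrix.mul_assoc, hα.2, hα.1]
        simp [J, fromBlocks_neg]

theorem conjTranspose_mul_Jρ_mul_apply {r : Type*} [Fintype r] [DecidableEq r]
    (H : HamiltonianSystem m) (X Y : Matrix (Fin m ⊕ Fin m) r ℂ) (k : ℤ) (i j : r) :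
    (Xᴴ * H.Jρ k * Y) i j = H.bracket k (X *ᵥ Pi.single i 1) (Y *ᵥ Pi.single j 1) := by
  rw [bracket, mulVec_mulVec, star_mulVec, ← dotProduct_mulVec, mulVec_mulVec, ← Matrix.mul_assoc,
    ← Pi.single_star, star_one, single_one_dotProduct, mulVec_single_one]
  rfl

/-- The initial value does not depend on the spectral parameter, so `initialValue_gram` gives the
value at `k₀`; constancy of the bracket, column by column, gives it everywhere. -/
theorem hatFundamental_gram (hH : H.IsAdmissible) (z : ℂ) (k₀ : ℤ)
    {α : Matrix (Fin m) (Fin m ⊕ Fin m) ℂ} (hα : IsBoundaryData α) (k : ℤ) :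
    (H.hatFundamental (star z) k₀ α k)ᴴ * H.Jρ k * H.hatFundamental z k₀ α k = -J m := by
  have h0 : (hat (H.fundamental (star z) k₀ α) k₀)ᴴ * H.Jρ k₀ * hat (H.fundamental z k₀ α) k₀ =
      -J m := by
    rw [hat_fundamental, hat_fundamental, initialValue_gram hH k₀ hα]
  rw [← h0, ← hat_fundamental_eq, ← hat_fundamental_eq]
  ext i j
  rw [conjTranspose_mul_Jρ_mul_apply, conjTranspose_mul_Jρ_mul_apply, hat_mulVec, hat_mulVec,
    hat_mulVec, hat_mulVec]
  exact bracket_eq_bracket hH (isSolution_fundamental_mulVec hH _ _ _ _)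
    (isSolution_fundamental_mulVec hH _ _ _ _) _ _

theorem hatFundamental_mul_J_mul (hH : H.IsAdmissible) (z : ℂ) (k₀ : ℤ)
    {α : Matrix (Fin m) (Fin m ⊕ Fin m) ℂ} (hα : IsBoundaryData α) (k : ℤ) :
    H.hatFundamental z k₀ α k * (J m * (H.hatFundamental (star z) k₀ α k)ᴴ * H.Jρ k) = 1 := by
  rw [mul_eq_one_comm, Matrix.mul_assoc, Matrix.mul_assoc, ← Matrix.mul_assoc _ (H.Jρ k),
    hatFundamental_gram hH z k₀ hα, Matrix.mul_neg, J_mul_J, neg_neg]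

/-- The Gram identity read in the reverse order, by uniqueness of the inverse; the right side is
`J_ρ(k)⁻¹`. Its blocks supply the jump of Green's matrix. -/
theorem hatFundamental_mul_J_mul_conjTranspose (hH : H.IsAdmissible) (z : ℂ) (k₀ : ℤ)
    {α : Matrix (Fin m) (Fin m ⊕ Fin m) ℂ} (hα : IsBoundaryData α) (k : ℤ) :
    H.hatFundamental z k₀ α k * J m * (H.hatFundamental (star z) k₀ α k)ᴴ =
      fromBlocks 0 (-(H.ρ k)⁻¹) (H.ρ k)⁻¹ 0 := by
  have h := hatFundamental_mul_J_mul hH z k₀ hα k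
  have h1 : H.Jρ k * fromBlocks 0 (-(H.ρ k)⁻¹) (H.ρ k)⁻¹ 0 = 1 := by
    simp [Jρ, fromBlocks_multiply, Matrix.mul_nonsing_inv _ (H.isUnit_ρ hH k)]
  calc _ = H.hatFundamental z k₀ α k * (J m * (H.hatFundamental (star z) k₀ α k)ᴴ * H.Jρ k) *
        fromBlocks 0 (-(H.ρ k)⁻¹) (H.ρ k)⁻¹ 0 := by
        conv_lhs => rw [← Matrix.mul_one (_ * _), ← h1]
        simp only [Matrix.mul_assoc]
    _ = _ := by rw [h, Matrix.one_mul]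

/-! ### Weyl solutions and Weyl disks -/

theorem weylSolution_eq (H : HamiltonianSystem m) (z : ℂ) (k₀ : ℤ)
    (α : Matrix (Fin m) (Fin m ⊕ Fin m) ℂ) (M : Matrix (Fin m) (Fin m) ℂ) (k : ℤ) :
    H.weylSolution z k₀ α M k =
      H.fundamental z k₀ α k * fromRows (1 : Matrix (Fin m) (Fin m) ℂ) M :=
  rfl

theorem isSolution_weylSolution_mulVec (hH : H.IsAdmissible) (z : ℂ) (k₀ : ℤ)
    (α : Matrix (Fin m) (Fin m ⊕ Fin m) ℂ) (M : Matrix (Fin m) (Fin m) ℂ) (v : Fin m → ℂ) :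
    H.IsSolution z (fun k => H.weylSolution z k₀ α M k *ᵥ v) := by
  simpa only [weylSolution_eq, mulVec_mulVec] using
    isSolution_fundamental_mulVec hH z k₀ α (fromRows (1 : Matrix (Fin m) (Fin m) ℂ) M *ᵥ v)

theorem hat_weylSolution (H : HamiltonianSystem m) (z : ℂ) (k₀ : ℤ)
    (α : Matrix (Fin m) (Fin m ⊕ Fin m) ℂ) (M : Matrix (Fin m) (Fin m) ℂ) (k : ℤ) :
    hat (H.weylSolution z k₀ α M) k = H.hatFundamental z k₀ α k * fromRows (1 : Matrix (Fin m) (Fin m) ℂ) M := by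
  rw [← hat_fundamental_eq, hat, hat, fromRows_mul, weylSolution_eq, weylSolution_eq]
  rfl

/-- The Gram identity sandwiched between `(I N^*)` and `(I; M)`. For `N = M^*` it vanishes, which is
the orthogonality behind the reflection of Weyl disks. -/
theorem weylSolution_gram (hH : H.IsAdmissible) (z : ℂ) (k₀ : ℤ)
    {α : Matrix (Fin m) (Fin m ⊕ Fin m) ℂ} (hα : IsBoundaryData α)
    (M N : Matrix (Fin m) (Fin m) ℂ) (k : ℤ) :
    (hat (H.weylSolution (star z) k₀ α N) k)ᴴ * H.Jρ k * hat (H.weylSolution z k₀ α M) k =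
      Nᴴ - M := by
  rw [hat_weylSolution, hat_weylSolution, conjTranspose_mul, ← Matrix.mul_assoc,
    Matrix.mul_assoc _ _ (H.Jρ k), Matrix.mul_assoc _ (_ * _) (H.hatFundamental _ _ _ _),
    hatFundamental_gram hH z k₀ hα, conjTranspose_fromRows_eq_fromCols_conjTranspose, J,
    fromBlocks_neg, fromCols_mul_fromBlocks, fromCols_mul_fromRows]
  simp [sub_eq_add_neg]

theorem bracket_weylSolution (hH : H.IsAdmissible) (z : ℂ) (k₀ : ℤ)
    {α : Matrix (Fin m) (Fin m ⊕ Fin m) ℂ} (hα : IsBoundaryData α)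
    (M N : Matrix (Fin m) (Fin m) ℂ) (k : ℤ) (u v : Fin m → ℂ) :
    H.bracket k (hat (H.weylSolution (star z) k₀ α N) k *ᵥ u)
      (hat (H.weylSolution z k₀ α M) k *ᵥ v) = star u ⬝ᵥ ((Nᴴ - M) *ᵥ v) := by
  rw [← weylSolution_gram hH z k₀ hα M N k, bracket, star_mulVec, ← dotProduct_mulVec,
    mulVec_mulVec, mulVec_mulVec]

theorem hat_weylSolution_mulVec_injective (hH : H.IsAdmissible) (z : ℂ) (k₀ : ℤ)
    {α : Matrix (Fin m) (Fin m ⊕ Fin m) ℂ} (hα : IsBoundaryData α)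
    (M : Matrix (Fin m) (Fin m) ℂ) (k : ℤ) {v : Fin m → ℂ}
    (hv : hat (H.weylSolution z k₀ α M) k *ᵥ v = 0) : v = 0 := by
  rw [hat_weylSolution, ← mulVec_mulVec] at hv
  have h := congrArg (fun w => (J m * (H.hatFundamental (star z) k₀ α k)ᴴ * H.Jρ k) *ᵥ w) hv
  simp only [mulVec_mulVec] at h
  rw [← Matrix.mul_assoc, mul_eq_one_comm.1 (hatFundamental_mul_J_mul hH z k₀ hα k),
    Matrix.one_mul, fromRows_mulVec, mulVec_zero, one_mulVec] at h
  funext i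
  exact congrFun h (Sum.inl i)

/-- The bracket is skew-Hermitian, so `-i [u,u]` is real and equals `Im [u,u]`; the matrix
inequality becomes a family of scalar sign conditions. -/
theorem mem_weylDisk_iff (hH : H.IsAdmissible) (z : ℂ) (k₀ : ℤ)
    (α : Matrix (Fin m) (Fin m ⊕ Fin m) ℂ) (ℓ : ℤ) (M : Matrix (Fin m) (Fin m) ℂ) :
    M ∈ H.weylDisk z k₀ α ℓ ↔ ∀ v : Fin m → ℂ,
      σ ℓ k₀ z * (H.bracket ℓ (hat (H.weylSolution z k₀ α M) ℓ *ᵥ v)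
        (hat (H.weylSolution z k₀ α M) ℓ *ᵥ v)).im ≤ 0 := by
  set U := hat (H.weylSolution z k₀ α M) ℓ with hU
  have hJ : (-Complex.I • H.Jρ ℓ).IsHermitian := by
    rw [IsHermitian, conjTranspose_smul, Jρ, fromBlocks_conjTranspose, conjTranspose_neg,
      (hH.ρ_pos ℓ).isHermitian.eq]
    simp [fromBlocks_smul, fromBlocks_neg]
  have hE : (H.weylE z k₀ α ℓ M).IsHermitian := by
    rw [weylE, IsHermitian, conjTranspose_smul, ← hU,
      (isHermitian_conjTranspose_mul_mul U hJ).eq]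
    simp
  have key (v : Fin m → ℂ) : star v ⬝ᵥ ((0 - H.weylE z k₀ α ℓ M) *ᵥ v) =
      ((-(σ ℓ k₀ z * (H.bracket ℓ (U *ᵥ v) (U *ᵥ v)).im) : ℝ) : ℂ) := by
    have h1 : star v ⬝ᵥ ((Uᴴ * (-Complex.I • H.Jρ ℓ) * U) *ᵥ v) =
        -Complex.I * H.bracket ℓ (U *ᵥ v) (U *ᵥ v) := by
      rw [bracket, star_mulVec, ← dotProduct_mulVec, mulVec_mulVec, mulVec_mulVec,
        Matrix.mul_smul, Matrix.smul_mul, smul_mulVec, dotProduct_smul, smul_eq_mul]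
    have h2 : H.bracket ℓ (U *ᵥ v) (U *ᵥ v) =
        Complex.I * ((H.bracket ℓ (U *ᵥ v) (U *ᵥ v)).im : ℂ) := by
      have := congrArg Complex.re (star_bracket hH ℓ (U *ᵥ v) (U *ᵥ v))
      rw [Complex.star_def, Complex.conj_re, Complex.neg_re] at this
      apply Complex.ext
      · simp; linarith
      · simp
    rw [weylE, ← hU, zero_sub, neg_mulVec, dotProduct_neg, smul_mulVec, dotProduct_smul, h1,
      smul_eq_mul, h2]
    generalize (H.bracket ℓ (U *ᵥ v) (U *ᵥ v)).im = t
    simp only [Complex.mul_im, Complex.I_re, Complex.I_im, Complex.ofReal_re, Complex.ofReal_im,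
      zero_mul, one_mul, zero_add]
    push_cast
    linear_combination ((σ ℓ k₀ z) * t : ℂ) * Complex.I_mul_I
  change H.weylE z k₀ α ℓ M ≤ 0 ↔ _
  rw [le_iff, posSemidef_iff_dotProduct_mulVec]
  constructor
  · intro h v
    have := h.2 v
    rw [key, Complex.zero_le_real] at this
    linarith
  · intro h
    refine ⟨isHermitian_zero.sub hE, fun v => ?_⟩
    rw [key, Complex.zero_le_real]
    linarith [h v]

theorem isClosed_weylDisk (hH : H.IsAdmissible) (z : ℂ) (k₀ : ℤ)
    (α : Matrix (Fin m) (Fin m ⊕ Fin m) ℂ) (ℓ : ℤ) : IsClosed (H.weylDisk z k₀ α ℓ) := by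
  have h : H.weylDisk z k₀ α ℓ = ⋂ v : Fin m → ℂ,
      {M | σ ℓ k₀ z * (H.bracket ℓ (hat (H.weylSolution z k₀ α M) ℓ *ᵥ v)
        (hat (H.weylSolution z k₀ α M) ℓ *ᵥ v)).im ≤ 0} := by
    ext M
    simp only [mem_weylDisk_iff hH, Set.mem_iInter, Set.mem_ofPred_eq]
  rw [h]
  refine isClosed_iInter fun v => isClosed_le ?_ continuous_const
  simp only [hat_weylSolution, ← mulVec_mulVec, bracket]
  have : Continuous fun M : Matrix (Fin m) (Fin m) ℂ =>
      H.hatFundamental z k₀ α ℓ *ᵥ (fromRows (1 : Matrix (Fin m) (Fin m) ℂ) M *ᵥ v) := by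
    simp only [fromRows_mulVec]
    refine continuous_const.matrix_mulVec (continuous_pi fun i => ?_)
    rcases i with i | i
    · exact continuous_const
    · exact (continuous_apply i).comp (continuous_id.matrix_mulVec continuous_const)
  refine continuous_const.mul (Complex.continuous_im.comp ?_)
  exact (continuous_star.comp this).dotProduct (continuous_const.matrix_mulVec this)

theorem isClosed_limitingDiskPlus (hH : H.IsAdmissible) (z : ℂ) (k₀ : ℤ)
    (α : Matrix (Fin m) (Fin m ⊕ Fin m) ℂ) : IsClosed (H.limitingDiskPlus z k₀ α) :=
  isClosed_iInter fun _ => isClosed_iInter fun _ => isClosed_weylDisk hH _ _ _ _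

theorem isClosed_limitingDiskMinus (hH : H.IsAdmissible) (z : ℂ) (k₀ : ℤ)
    (α : Matrix (Fin m) (Fin m ⊕ Fin m) ℂ) : IsClosed (H.limitingDiskMinus z k₀ α) :=
  isClosed_iInter fun _ => isClosed_iInter fun _ => isClosed_weylDisk hH _ _ _ _

theorem σ_star (ℓ k : ℤ) (z : ℂ) : σ ℓ k (star z) = -σ ℓ k z := by
  simp [σ, neg_div]

theorem σ_eq_sign (ℓ k : ℤ) (z : ℂ) : σ ℓ k z = SignType.sign (((ℓ - k : ℤ) : ℝ) * z.im) := by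
  rcases lt_trichotomy (((ℓ - k : ℤ) : ℝ) * z.im) 0 with h | h | h
  · rw [σ, abs_of_neg h, div_neg, div_self h.ne, sign_neg h]; simp
  · rw [σ, h]; simp
  · rw [σ, abs_of_pos h, div_self h.ne', sign_pos h]; simp

theorem bracket_add_smul (hH : H.IsAdmissible) (ℓ : ℤ) {x y : Fin m ⊕ Fin m → ℂ}
    (hxy : H.bracket ℓ x y = 0) (c : ℂ) :
    H.bracket ℓ (c • x + y) (c • x + y) = Complex.normSq c * H.bracket ℓ x x + H.bracket ℓ y y := by
  have hyx : H.bracket ℓ y x = 0 := by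
    rw [← neg_eq_zero, ← star_bracket hH, hxy, star_zero]
  unfold bracket at *
  simp only [mulVec_add, mulVec_smul, star_add, star_smul, add_dotProduct, dotProduct_add,
    smul_dotProduct, dotProduct_smul, hxy, hyx, smul_eq_mul, Complex.normSq_eq_conj_mul_self,
    Complex.star_def]
  ring

/-- The form `s Im (x^* J_ρ x)` is positive on the graph `x₂ = s i x₁`. -/
theorem bracket_pos_of_graph (hH : H.IsAdmissible) (ℓ : ℤ) {s : ℝ} (hs : s * s = 1)
    {x : Fin m ⊕ Fin m → ℂ}
    (hx : x ∘ Sum.inr = (s * Complex.I : ℂ) • (x ∘ Sum.inl)) (hx0 : x ≠ 0) :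
    0 < s * (H.bracket ℓ x x).im := by
  set a := x ∘ Sum.inl with ha
  have ha0 : a ≠ 0 := by
    intro h0
    rw [h0, smul_zero] at hx
    apply hx0
    funext i
    rcases i with i | i
    · exact congrFun h0 i
    · exact congrFun hx i
  have hpos := (hH.ρ_pos ℓ).dotProduct_mulVec_pos ha0
  have him := im_star_dotProduct_mulVec (hH.ρ_pos ℓ).isHermitian a
  rw [bracket_eq, hx, ← ha, mulVec_smul, dotProduct_smul, star_smul, smul_dotProduct]
  have hre : 0 < (star a ⬝ᵥ (H.ρ ℓ *ᵥ a)).re := (Complex.lt_def.1 hpos).1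
  have : ((s * Complex.I : ℂ) • (star a ⬝ᵥ (H.ρ ℓ *ᵥ a)) -
      star (s * Complex.I : ℂ) • (star a ⬝ᵥ (H.ρ ℓ *ᵥ a))).im =
      2 * s * (star a ⬝ᵥ (H.ρ ℓ *ᵥ a)).re := by
    simp
    ring
  rw [this]
  nlinarith

/-! ### Reflection of the disks under `z ↦ z̄` -/

/-- An inertia argument for `s Im [·,·]`, which is nonpositive on the `m`-dimensional range of
`Û_M(z)`. A vector `x` in the range of `Û_{M^*}(z̄)` is orthogonal to that range. Were the form
negative at `x`, it would be nonpositive on an `(m+1)`-dimensional space, which must meet the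
`m`-dimensional graph where it is positive. -/
theorem conjTranspose_mem_weylDisk (hH : H.IsAdmissible) {z : ℂ} (hz : z.im ≠ 0) {k₀ : ℤ}
    {α : Matrix (Fin m) (Fin m ⊕ Fin m) ℂ} (hα : IsBoundaryData α) {ℓ : ℤ} (hℓ : ℓ ≠ k₀)
    {M : Matrix (Fin m) (Fin m) ℂ} (hM : M ∈ H.weylDisk z k₀ α ℓ) :
    Mᴴ ∈ H.weylDisk (star z) k₀ α ℓ := by
  rw [mem_weylDisk_iff hH] at hM ⊢
  intro w
  set x := hat (H.weylSolution (star z) k₀ α Mᴴ) ℓ *ᵥ w with hx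
  set Y := hat (H.weylSolution z k₀ α M) ℓ with hY
  set s := σ ℓ k₀ z with hs
  have hss : s * s = 1 := by
    have : (((ℓ - k₀ : ℤ) : ℝ) * z.im) ≠ 0 :=
      mul_ne_zero (by exact_mod_cast sub_ne_zero.2 hℓ) hz
    rw [hs, σ_eq_sign]
    rcases this.lt_or_gt with h | h
    · rw [sign_neg h]; simp
    · rw [sign_pos h]; simp
  rw [σ_star, ← hs]
  by_contra! hneg
  have hxY (v : Fin m → ℂ) : H.bracket ℓ x (Y *ᵥ v) = 0 := by
    rw [hx, hY, bracket_weylSolution hH z k₀ hα]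
    simp
  let p₁ : (Fin m ⊕ Fin m → ℂ) →ₗ[ℂ] (Fin m → ℂ) := LinearMap.funLeft ℂ ℂ Sum.inl
  let p₂ : (Fin m ⊕ Fin m → ℂ) →ₗ[ℂ] (Fin m → ℂ) := LinearMap.funLeft ℂ ℂ Sum.inr
  -- `T` measures how far `c x + Y v` is from the graph `u₂ = s i u₁`. It maps dimension `m + 1` to
  -- dimension `m`, so its kernel is nonzero.
  let T : ℂ × (Fin m → ℂ) →ₗ[ℂ] (Fin m → ℂ) :=
    (p₂ - (s * Complex.I : ℂ) • p₁) ∘ₗ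
      ((LinearMap.toSpanSingleton ℂ _ x).coprod Y.mulVecLin)
  have hT : LinearMap.ker T ≠ ⊥ := by
    apply LinearMap.ker_ne_bot_of_finrank_lt
    simp
  obtain ⟨⟨c, v⟩, hcv, hcv0⟩ := Submodule.exists_mem_ne_zero_of_ne_bot hT
  set u := c • x + Y *ᵥ v with hu
  have hgraph : u ∘ Sum.inr = (s * Complex.I : ℂ) • (u ∘ Sum.inl) := sub_eq_zero.1 hcv
  have hform : s * (H.bracket ℓ u u).im =
      -(Complex.normSq c * (-s * (H.bracket ℓ x x).im)) +
        s * (H.bracket ℓ (Y *ᵥ v) (Y *ᵥ v)).im := by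
    rw [hu, bracket_add_smul hH ℓ (hxY v), Complex.add_im, Complex.im_ofReal_mul]
    ring
  have hle := hM v
  have hc : 0 ≤ Complex.normSq c := Complex.normSq_nonneg c
  -- A nonzero kernel element might still give `u = 0`; then strict negativity at `x` forces `c =
  -- 0`, and injectivity of `Y` forces `v = 0`.
  by_cases hu0 : u = 0
  · have hb : H.bracket ℓ u u = 0 := by simp [hu0, bracket]
    rw [hb, Complex.zero_im, mul_zero] at hform
    have hc0 : Complex.normSq c = 0 := by nlinarith
    rw [Complex.normSq_eq_zero] at hc0
    rw [hu, hc0, zero_smul, zero_add] at hu0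
    exact hcv0 (Prod.ext hc0 (hat_weylSolution_mulVec_injective hH z k₀ hα M ℓ hu0))
  · have := bracket_pos_of_graph hH ℓ hss hgraph hu0
    nlinarith [mul_nonneg hc hneg.le]

theorem weylDisk_star (hH : H.IsAdmissible) {z : ℂ} (hz : z.im ≠ 0) {k₀ : ℤ}
    {α : Matrix (Fin m) (Fin m ⊕ Fin m) ℂ} (hα : IsBoundaryData α) {ℓ : ℤ} (hℓ : ℓ ≠ k₀)
    (M : Matrix (Fin m) (Fin m) ℂ) :
    Mᴴ ∈ H.weylDisk (star z) k₀ α ℓ ↔ M ∈ H.weylDisk z k₀ α ℓ := by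
  refine ⟨fun h => ?_, conjTranspose_mem_weylDisk hH hz hα hℓ⟩
  simpa using conjTranspose_mem_weylDisk hH (z := star z) (by simpa using hz) hα hℓ h

/-- The conjugate transposition as a homeomorphism. -/
def conjTransposeHomeomorph (m : ℕ) : Matrix (Fin m) (Fin m) ℂ ≃ₜ Matrix (Fin m) (Fin m) ℂ where
  toFun M := Mᴴ
  invFun M := Mᴴ
  left_inv := conjTranspose_conjTranspose
  right_inv := conjTranspose_conjTranspose
  continuous_toFun := continuous_id.matrix_conjTranspose
  continuous_invFun := continuous_id.matrix_conjTranspose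

theorem conjTranspose_mem_frontier {D E : Set (Matrix (Fin m) (Fin m) ℂ)}
    (h : ∀ M, Mᴴ ∈ E ↔ M ∈ D) {M : Matrix (Fin m) (Fin m) ℂ} (hM : M ∈ frontier D) :
    Mᴴ ∈ frontier E := by
  have hD : D = conjTransposeHomeomorph m ⁻¹' E := Set.ext fun M => (h M).symm
  rw [hD, ← Homeomorph.preimage_frontier] at hM
  exact hM

theorem limitingDiskPlus_star (hH : H.IsAdmissible) {z : ℂ} (hz : z.im ≠ 0) {k₀ : ℤ}
    {α : Matrix (Fin m) (Fin m ⊕ Fin m) ℂ} (hα : IsBoundaryData α)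
    (M : Matrix (Fin m) (Fin m) ℂ) :
    Mᴴ ∈ H.limitingDiskPlus (star z) k₀ α ↔ M ∈ H.limitingDiskPlus z k₀ α := by
  simp only [limitingDiskPlus, Set.mem_iInter]
  exact forall₂_congr fun ℓ hℓ => weylDisk_star hH hz hα hℓ.ne' M

theorem limitingDiskMinus_star (hH : H.IsAdmissible) {z : ℂ} (hz : z.im ≠ 0) {k₀ : ℤ}
    {α : Matrix (Fin m) (Fin m ⊕ Fin m) ℂ} (hα : IsBoundaryData α)
    (M : Matrix (Fin m) (Fin m) ℂ) :
    Mᴴ ∈ H.limitingDiskMinus (star z) k₀ α ↔ M ∈ H.limitingDiskMinus z k₀ α := by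
  simp only [limitingDiskMinus, Set.mem_iInter]
  exact forall₂_congr fun ℓ hℓ => weylDisk_star hH hz hα hℓ.ne M

/-! ### Sums of densities -/

theorem density_nonneg (hH : H.IsAdmissible) (x : ℤ → Fin m ⊕ Fin m → ℂ) (k : ℤ) :
    0 ≤ H.density x k :=
  (Complex.le_def.1 ((hH.A_nonneg k).dotProduct_mulVec_nonneg (x k))).1

/-- Positivity of `A` on `t x + c f`. The unit `c` selects a real or imaginary part; `t = 1` serves
summability, `t = Im z` the norm bound. -/
theorem two_mul_re_le_density (hH : H.IsAdmissible) (x f : ℤ → Fin m ⊕ Fin m → ℂ) (k : ℤ) (t : ℝ)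
    {c : ℂ} (hc : Complex.normSq c = 1) :
    -(2 * t * (c * (star (x k) ⬝ᵥ (H.A k *ᵥ f k))).re) ≤
      t ^ 2 * H.density x k + H.density f k := by
  have h := (Complex.le_def.1
    ((hH.A_nonneg k).dotProduct_mulVec_nonneg ((t : ℂ) • x k + c • f k))).1
  have hsymm : star (f k) ⬝ᵥ (H.A k *ᵥ x k) = star (star (x k) ⬝ᵥ (H.A k *ᵥ f k)) := by
    rw [star_star_dotProduct, star_mulVec_dotProduct (hH.A_nonneg k).isHermitian]
  have hx := im_star_dotProduct_mulVec (hH.A_nonneg k).isHermitian (x k)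
  have hf := im_star_dotProduct_mulVec (hH.A_nonneg k).isHermitian (f k)
  simp only [mulVec_add, mulVec_smul, star_add, star_smul, add_dotProduct, dotProduct_add,
    smul_dotProduct, dotProduct_smul, smul_eq_mul, hsymm] at h
  rw [Complex.normSq_apply] at hc
  simp only [density]
  simp only [Complex.zero_re, Complex.add_re, Complex.add_im, Complex.mul_re, Complex.mul_im,
    Complex.star_def,
    Complex.conj_re, Complex.conj_im, Complex.ofReal_re, Complex.ofReal_im, hx, hf] at h ⊢
  generalize (star (x k) ⬝ᵥ (H.A k *ᵥ x k)).re = a at *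
  generalize (star (f k) ⬝ᵥ (H.A k *ᵥ f k)).re = b at *
  linear_combination h + b * hc

theorem norm_dotProduct_le_density (hH : H.IsAdmissible) (x f : ℤ → Fin m ⊕ Fin m → ℂ) (k : ℤ) :
    ‖star (x k) ⬝ᵥ (H.A k *ᵥ f k)‖ ≤ H.density x k + H.density f k := by
  refine (Complex.norm_le_abs_re_add_abs_im _).trans ?_
  have h1 := two_mul_re_le_density hH x f k 1 (c := 1) (by simp)
  have h2 := two_mul_re_le_density hH x f k 1 (c := -1) (by simp)
  have h3 := two_mul_re_le_density hH x f k 1 (c := Complex.I) (by simp)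
  have h4 := two_mul_re_le_density hH x f k 1 (c := -Complex.I) (by simp)
  simp only [Complex.mul_re, Complex.I_re, Complex.I_im, Complex.neg_re, Complex.neg_im,
    Complex.one_re, Complex.one_im] at h1 h2 h3 h4
  have h5 : |(star (x k) ⬝ᵥ (H.A k *ᵥ f k)).re| ≤ (H.density x k + H.density f k) / 2 :=
    abs_le.2 ⟨by linarith, by linarith⟩
  have h6 : |(star (x k) ⬝ᵥ (H.A k *ᵥ f k)).im| ≤ (H.density x k + H.density f k) / 2 :=
    abs_le.2 ⟨by linarith, by linarith⟩
  linarith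

theorem MemL2A.summable_dotProduct (hH : H.IsAdmissible) {x f : ℤ → Fin m ⊕ Fin m → ℂ}
    (hx : H.MemL2A x) (hf : H.MemL2A f) :
    Summable fun k => star (x k) ⬝ᵥ (H.A k *ᵥ f k) :=
  .of_norm_bounded (hx.add hf) (norm_dotProduct_le_density hH x f)

theorem sum_Ioc_sub_sub_one (g : ℤ → ℝ) {a b : ℤ} (hab : a ≤ b) :
    ∑ k ∈ Finset.Ioc a b, (g k - g (k - 1)) = g b - g a := by
  induction b, hab using Int.leInduction with
  | base => simp
  | succ b hab ih =>
    have h : Finset.Ioc a (b + 1) = insert (b + 1) (Finset.Ioc a b) := by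
      ext k
      simp only [Finset.mem_insert, Finset.mem_Ioc]
      omega
    rw [h, Finset.sum_insert (by simp), ih, add_sub_cancel_right]
    ring

theorem sum_density_of_isSolution (hH : H.IsAdmissible) {z : ℂ} {x : ℤ → Fin m ⊕ Fin m → ℂ}
    (hx : H.IsSolution z x) {a b : ℤ} (hab : a ≤ b) :
    2 * z.im * ∑ k ∈ Finset.Ioc a b, H.density x k =
      (H.bracket b (hatVec x b) (hatVec x b)).im - (H.bracket a (hatVec x a) (hatVec x a)).im := by
  rw [← sum_Ioc_sub_sub_one (fun k => (H.bracket k (hatVec x k) (hatVec x k)).im) hab,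
    Finset.mul_sum]
  exact Finset.sum_congr rfl fun k _ => (im_bracket_sub_of_isSolution hH hx k).symm

theorem σ_mul_im_of_lt {ℓ k : ℤ} (h : k < ℓ) (z : ℂ) : σ ℓ k z * z.im = |z.im| := by
  have h' : (0 : ℝ) < ((ℓ - k : ℤ) : ℝ) := by exact_mod_cast sub_pos.2 h
  rw [σ_eq_sign, sign_mul, sign_pos h', one_mul, sign_mul_self]

theorem σ_mul_im_of_gt {ℓ k : ℤ} (h : ℓ < k) (z : ℂ) : σ ℓ k z * z.im = -|z.im| := by
  have h' : ((ℓ - k : ℤ) : ℝ) < 0 := by exact_mod_cast sub_neg.2 h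
  rw [σ_eq_sign, sign_mul, sign_neg h', SignType.coe_mul, SignType.coe_neg, SignType.coe_one,
    neg_one_mul, neg_mul, sign_mul_self]

theorem abs_σ_le_one (ℓ k : ℤ) (z : ℂ) : |σ ℓ k z| ≤ 1 := by
  rw [σ, abs_div, abs_abs]
  exact div_self_le_one _

/-- The telescoped growth law with the boundary term at `ℓ` discarded by its sign. What remains
depends on `ℓ` only through `σ`, hence is bounded uniformly. -/
theorem sum_density_le_of_mem_limitingDiskPlus (hH : H.IsAdmissible) {z : ℂ} {k₀ : ℤ}
    {α : Matrix (Fin m) (Fin m ⊕ Fin m) ℂ} {M : Matrix (Fin m) (Fin m) ℂ}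
    (hM : M ∈ H.limitingDiskPlus z k₀ α) (v : Fin m → ℂ) {ℓ : ℤ} (hℓ : k₀ < ℓ) :
    2 * |z.im| * ∑ k ∈ Finset.Ioc k₀ ℓ, H.density (fun k => H.weylSolution z k₀ α M k *ᵥ v) k ≤
      -(σ ℓ k₀ z * (H.bracket k₀ (hat (H.weylSolution z k₀ α M) k₀ *ᵥ v)
        (hat (H.weylSolution z k₀ α M) k₀ *ᵥ v)).im) := by
  have h1 := (mem_weylDisk_iff hH z k₀ α ℓ M).1 (Set.mem_iInter₂.1 hM ℓ hℓ) v
  have h2 := sum_density_of_isSolution hH (isSolution_weylSolution_mulVec hH z k₀ α M v) hℓ.le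
  simp only [← hat_mulVec] at h2
  rw [← σ_mul_im_of_lt hℓ]
  linear_combination h1 + σ ℓ k₀ z * h2

theorem sum_density_le_of_mem_limitingDiskMinus (hH : H.IsAdmissible) {z : ℂ} {k₀ : ℤ}
    {α : Matrix (Fin m) (Fin m ⊕ Fin m) ℂ} {M : Matrix (Fin m) (Fin m) ℂ}
    (hM : M ∈ H.limitingDiskMinus z k₀ α) (v : Fin m → ℂ) {ℓ : ℤ} (hℓ : ℓ < k₀) :
    2 * |z.im| * ∑ k ∈ Finset.Ioc ℓ k₀, H.density (fun k => H.weylSolution z k₀ α M k *ᵥ v) k ≤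
      -(σ ℓ k₀ z * (H.bracket k₀ (hat (H.weylSolution z k₀ α M) k₀ *ᵥ v)
        (hat (H.weylSolution z k₀ α M) k₀ *ᵥ v)).im) := by
  have h1 := (mem_weylDisk_iff hH z k₀ α ℓ M).1 (Set.mem_iInter₂.1 hM ℓ hℓ) v
  have h2 := sum_density_of_isSolution hH (isSolution_weylSolution_mulVec hH z k₀ α M v) hℓ.le
  simp only [← hat_mulVec] at h2
  have h3 := σ_mul_im_of_gt hℓ z
  rw [← neg_eq_iff_eq_neg] at h3
  rw [← h3]
  linear_combination h1 - σ ℓ k₀ z * h2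

theorem neg_σ_mul_le (ℓ k : ℤ) (z : ℂ) (t : ℝ) : -(σ ℓ k z * t) ≤ |t| := by
  have := abs_mul (σ ℓ k z) t
  have h1 := abs_σ_le_one ℓ k z
  have h2 := neg_abs_le (σ ℓ k z * t)
  nlinarith [abs_nonneg t]

theorem summable_indicator_Ioi {g : ℤ → ℝ} (hg : ∀ k, 0 ≤ g k) {k₀ : ℤ} {C : ℝ}
    (h : ∀ ℓ, k₀ < ℓ → ∑ k ∈ Finset.Ioc k₀ ℓ, g k ≤ C) :
    Summable ((Set.Ioi k₀).indicator g) := by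
  classical
  refine summable_of_sum_le (c := C) (fun k => Set.indicator_nonneg (fun k _ => hg k) k)
    fun u => ?_
  obtain ⟨b, hb⟩ := u.bddAbove
  refine le_trans ?_ (h (max b (k₀ + 1)) (by omega))
  rw [Finset.sum_indicator_eq_sum_filter]
  refine Finset.sum_le_sum_of_subset_of_nonneg (fun k hk => ?_) fun k _ _ => hg k
  rw [Finset.mem_filter] at hk
  exact Finset.mem_Ioc.2 ⟨hk.2, (hb hk.1).trans (le_max_left _ _)⟩

theorem summable_indicator_Iic {g : ℤ → ℝ} (hg : ∀ k, 0 ≤ g k) {k₀ : ℤ} {C : ℝ}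
    (h : ∀ ℓ, ℓ < k₀ → ∑ k ∈ Finset.Ioc ℓ k₀, g k ≤ C) :
    Summable ((Set.Iic k₀).indicator g) := by
  classical
  refine summable_of_sum_le (c := C) (fun k => Set.indicator_nonneg (fun k _ => hg k) k)
    fun u => ?_
  obtain ⟨b, hb⟩ := u.bddBelow
  refine le_trans ?_ (h (min (b - 1) (k₀ - 1)) (by omega))
  rw [Finset.sum_indicator_eq_sum_filter]
  refine Finset.sum_le_sum_of_subset_of_nonneg (fun k hk => ?_) fun k _ _ => hg k
  rw [Finset.mem_filter] at hk
  have := hb hk.1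
  exact Finset.mem_Ioc.2 ⟨by omega, hk.2⟩

theorem summable_density_Ioi (hH : H.IsAdmissible) {z : ℂ} (hz : z.im ≠ 0) {k₀ : ℤ}
    {α : Matrix (Fin m) (Fin m ⊕ Fin m) ℂ} {M : Matrix (Fin m) (Fin m) ℂ}
    (hM : M ∈ H.limitingDiskPlus z k₀ α) (v : Fin m → ℂ) :
    Summable ((Set.Ioi k₀).indicator
      (H.density fun k => H.weylSolution z k₀ α M k *ᵥ v)) := by
  have hz' : 0 < 2 * |z.im| := by positivity
  exact summable_indicator_Ioi (density_nonneg hH _) fun ℓ hℓ => (le_div_iff₀' hz').2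
    ((sum_density_le_of_mem_limitingDiskPlus hH hM v hℓ).trans (neg_σ_mul_le _ _ _ _))

theorem summable_density_Iic (hH : H.IsAdmissible) {z : ℂ} (hz : z.im ≠ 0) {k₀ : ℤ}
    {α : Matrix (Fin m) (Fin m ⊕ Fin m) ℂ} {M : Matrix (Fin m) (Fin m) ℂ}
    (hM : M ∈ H.limitingDiskMinus z k₀ α) (v : Fin m → ℂ) :
    Summable ((Set.Iic k₀).indicator
      (H.density fun k => H.weylSolution z k₀ α M k *ᵥ v)) := by
  have hz' : 0 < 2 * |z.im| := by positivity
  exact summable_indicator_Iic (density_nonneg hH _) fun ℓ hℓ => (le_div_iff₀' hz').2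
    ((sum_density_le_of_mem_limitingDiskMinus hH hM v hℓ).trans (neg_σ_mul_le _ _ _ _))

/-- The disks control the tails beyond `k₀`, while `f` is glued at `k`; the finitely many sites
between them do not affect summability. -/
theorem memL2A_of_eq_weylSolution (hH : H.IsAdmissible) {z : ℂ} (hz : z.im ≠ 0) {k₀ : ℤ}
    {α : Matrix (Fin m) (Fin m ⊕ Fin m) ℂ} {Mp Mm : Matrix (Fin m) (Fin m) ℂ}
    (hMp : Mp ∈ H.limitingDiskPlus z k₀ α) (hMm : Mm ∈ H.limitingDiskMinus z k₀ α)
    {f : ℤ → Fin m ⊕ Fin m → ℂ} {k : ℤ} {v w : Fin m → ℂ}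
    (hp : ∀ ℓ, k < ℓ → f ℓ = H.weylSolution z k₀ α Mp ℓ *ᵥ v)
    (hm : ∀ ℓ, ℓ < k → f ℓ = H.weylSolution z k₀ α Mm ℓ *ᵥ w) : H.MemL2A f := by
  refine ((summable_density_Ioi hH hz hMp v).add (summable_density_Iic hH hz hMm w)).congr_cofinite
    ((Set.finite_Icc (min k k₀) (max k k₀)).subset fun ℓ hℓ => ?_)
  by_contra hout
  rw [Set.mem_Icc, not_and_or, not_le, not_le] at hout
  apply hℓ
  change Set.indicator _ _ ℓ + Set.indicator _ _ ℓ = H.density f ℓ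
  rcases hout with h | h
  · rw [Set.indicator_of_notMem (by simp; omega),
      Set.indicator_of_mem (by simp; omega), zero_add, density, density, hm ℓ (by omega)]
  · rw [Set.indicator_of_mem (by simp; omega),
      Set.indicator_of_notMem (by simp; omega), add_zero, density, density, hp ℓ (by omega)]

/-! ### The matrix `ω` -/

/-- If `M_- v = M_+ v`, the two Weyl solutions with vector `v` coincide. Adding the disk estimates
on both sides of `k₀` cancels the bracket at `k₀` and bounds a positive sum of densities by zero. -/
theorem isUnit_sub (hH : H.IsAdmissible) {z : ℂ} (hz : z.im ≠ 0) {k₀ : ℤ}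
    {α : Matrix (Fin m) (Fin m ⊕ Fin m) ℂ} (hα : IsBoundaryData α)
    {Mp Mm : Matrix (Fin m) (Fin m) ℂ}
    (hMp : Mp ∈ H.limitingDiskPlus z k₀ α) (hMm : Mm ∈ H.limitingDiskMinus z k₀ α) :
    IsUnit (Mm - Mp) := by
  rw [Matrix.isUnit_iff_isUnit_det, isUnit_iff_ne_zero]
  intro hdet
  obtain ⟨v, hv0, hv⟩ := exists_mulVec_eq_zero_iff.2 hdet
  rw [sub_mulVec, sub_eq_zero] at hv
  have hU (k : ℤ) : H.weylSolution z k₀ α Mm k *ᵥ v = H.weylSolution z k₀ α Mp k *ᵥ v := by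
    simp only [weylSolution_eq, ← mulVec_mulVec, fromRows_mulVec, hv]
  -- Definiteness needs at least two sites, here `k₀ + 1` and `k₀ + 2`; the left end `k₀ - 2`
  -- mirrors this so that the values of `σ` are opposite.
  have h1 := sum_density_le_of_mem_limitingDiskPlus hH hMp v (ℓ := k₀ + 2) (by omega)
  have h2 := sum_density_le_of_mem_limitingDiskMinus hH hMm v (ℓ := k₀ - 2) (by omega)
  have hsol := isSolution_weylSolution_mulVec hH z k₀ α Mp v
  have hne : (fun k => H.weylSolution z k₀ α Mp k *ᵥ v) ≠ 0 := by
    intro h0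
    apply hv0
    refine hat_weylSolution_mulVec_injective hH z k₀ hα Mp k₀ ?_
    rw [hat_mulVec, h0]
    funext i
    rcases i with i | i <;> rfl
  have hpos := hH.definite z _ hsol hne (k₀ + 1) (k₀ + 2) (by omega)
  have hIoc : Finset.Ioc k₀ (k₀ + 2) = Finset.Icc (k₀ + 1) (k₀ + 2) := by
    ext; simp only [Finset.mem_Ioc, Finset.mem_Icc]; omega
  rw [hIoc] at h1
  rw [hat_mulVec] at h1 h2
  simp only [hU] at h2
  have hσ : σ (k₀ - 2) k₀ z = -σ (k₀ + 2) k₀ z := by simp [σ, neg_div]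
  rw [hσ] at h2
  have hn := Finset.sum_nonneg fun k (_ : k ∈ Finset.Ioc (k₀ - 2) k₀) =>
    density_nonneg hH (fun k => H.weylSolution z k₀ α Mp k *ᵥ v) k
  have hz' : 0 < |z.im| := abs_pos.2 hz
  have := mul_pos hz' hpos
  have := mul_nonneg hz'.le hn
  linarith

theorem omega_eq_inv_gram (hH : H.IsAdmissible) (z : ℂ) (k₀ : ℤ)
    {α : Matrix (Fin m) (Fin m ⊕ Fin m) ℂ} (hα : IsBoundaryData α)
    (Mp Mm : Matrix (Fin m) (Fin m) ℂ) (k : ℤ) :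
    omega Mp Mm = ((hat (H.weylSolution (star z) k₀ α Mmᴴ) k)ᴴ * H.Jρ k *
      hat (H.weylSolution z k₀ α Mp) k)⁻¹ := by
  rw [weylSolution_gram hH z k₀ hα, conjTranspose_conjTranspose, omega]

theorem omega_eq_neg_inv_gram (hH : H.IsAdmissible) (z : ℂ) (k₀ : ℤ)
    {α : Matrix (Fin m) (Fin m ⊕ Fin m) ℂ} (hα : IsBoundaryData α)
    {Mp Mm : Matrix (Fin m) (Fin m) ℂ} (h : IsUnit (Mm - Mp)) (k : ℤ) :
    omega Mp Mm = -((hat (H.weylSolution (star z) k₀ α Mpᴴ) k)ᴴ * H.Jρ k *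
      hat (H.weylSolution z k₀ α Mm) k)⁻¹ := by
  have h' := Matrix.mul_nonsing_inv _ ((Matrix.isUnit_iff_isUnit_det _).1 h)
  rw [weylSolution_gram hH z k₀ hα, conjTranspose_conjTranspose, omega, ← neg_sub Mm Mp,
    Matrix.inv_eq_right_inv (A := -(Mm - Mp)) (B := -(Mm - Mp)⁻¹) (by rw [neg_mul_neg, h']), neg_neg]

/-! ### Green's matrix -/

/-- `Ψ(k)` takes its upper rows from `Ψ̂(k)` and its lower rows from `Ψ̂(k-1)`, so the diagonal
blocks of `Ψ J Ψ^*` vanish by the inverse Gram identity at `k` and `k - 1`. The off-diagonal blocks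
mix the two sites; the system equation, used through the blocks of `z A + B`, moves each to a single
site. -/
theorem fundamental_jump (hH : H.IsAdmissible) (z : ℂ) (k₀ : ℤ)
    {α : Matrix (Fin m) (Fin m ⊕ Fin m) ℂ} (hα : IsBoundaryData α) (k : ℤ) :
    fromBlocks 0 (H.coeff z k).toBlocks₁₂ (-(H.coeff z k).toBlocks₂₁) 0 *
      (H.fundamental z k₀ α k * J m * (H.fundamental (star z) k₀ α k)ᴴ) = 1 := by
  have hk := hatFundamental_mul_J_mul_conjTranspose hH z k₀ hα k
  have hk' := hatFundamental_mul_J_mul_conjTranspose hH z k₀ hα (k - 1)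
  have heq := fundamental_eq hH z k₀ α k
  rw [← fromBlocks_toBlocks (H.coeff z k)] at heq
  rw [fundamental] at heq
  rw [fundamental, fundamental]
  set F := H.hatFundamental z k₀ α k
  set G := H.hatFundamental (star z) k₀ α k
  set F' := H.hatFundamental z k₀ α (k - 1)
  set G' := H.hatFundamental (star z) k₀ α (k - 1)
  rw [← fromRows_toRows F, ← fromRows_toRows G, conjTranspose_fromRows_eq_fromCols_conjTranspose,
    fromRows_mul, fromRows_mul_fromCols, fromBlocks_inj] at hk
  rw [← fromRows_toRows F', ← fromRows_toRows G', conjTranspose_fromRows_eq_fromCols_conjTranspose,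
    fromRows_mul, fromRows_mul_fromCols, fromBlocks_inj] at hk'
  rw [fromBlocks_mul_fromRows, fromRows_ext_iff] at heq
  obtain ⟨h1, h2⟩ := heq
  have hb : (H.coeff z k).toBlocks₁₂ * F'.toRows₂ =
      H.ρ k * F.toRows₂ - (H.coeff z k).toBlocks₁₁ * F.toRows₁ := by rw [h1]; abel
  have hc : (H.coeff z k).toBlocks₂₁ * F.toRows₁ =
      H.ρ (k - 1) * F'.toRows₁ - (H.coeff z k).toBlocks₂₂ * F'.toRows₂ := by rw [h2]; abel
  rw [conjTranspose_fromRows_eq_fromCols_conjTranspose, fromRows_mul, fromRows_mul_fromCols,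
    fromBlocks_multiply, ← fromBlocks_one]
  simp only [Matrix.zero_mul, zero_add, add_zero, Matrix.neg_mul]
  congr 1
  · rw [← Matrix.mul_assoc, ← Matrix.mul_assoc, hb, Matrix.sub_mul, Matrix.sub_mul,
      Matrix.mul_assoc (H.ρ k), Matrix.mul_assoc (H.ρ k), hk.2.2.1, Matrix.mul_assoc (toBlocks₁₁ _),
      Matrix.mul_assoc (toBlocks₁₁ _), hk.1, Matrix.mul_zero, sub_zero,
      Matrix.mul_nonsing_inv _ (H.isUnit_ρ hH k)]
  · rw [hk'.2.2.2, Matrix.mul_zero]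
  · rw [hk.1, Matrix.mul_zero, neg_zero]
  · rw [← Matrix.mul_assoc, ← Matrix.mul_assoc, hc, Matrix.sub_mul, Matrix.sub_mul,
      Matrix.mul_assoc (H.ρ (k - 1)), Matrix.mul_assoc (H.ρ (k - 1)), hk'.2.1,
      Matrix.mul_assoc (toBlocks₂₂ _), Matrix.mul_assoc (toBlocks₂₂ _), hk'.2.2.2,
      Matrix.mul_zero, sub_zero, Matrix.mul_neg, Matrix.mul_nonsing_inv _ (H.isUnit_ρ hH _),
      neg_neg]

/-- After factoring out `Ψ`, this is the identity `(I; M_+) ω (I M_-) - (I; M_-) ω (I M_+) = J`,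
which follows from `ω` being the inverse of `M_- - M_+`. -/
theorem weylSolution_omega_sub {Mp Mm : Matrix (Fin m) (Fin m) ℂ} (h : IsUnit (Mm - Mp))
    (z : ℂ) (k₀ : ℤ) (α : Matrix (Fin m) (Fin m ⊕ Fin m) ℂ) (k : ℤ) :
    H.weylSolution z k₀ α Mp k * omega Mp Mm * (H.weylSolution (star z) k₀ α Mmᴴ k)ᴴ -
      H.weylSolution z k₀ α Mm k * omega Mp Mm * (H.weylSolution (star z) k₀ α Mpᴴ k)ᴴ =
    H.fundamental z k₀ α k * J m * (H.fundamental (star z) k₀ α k)ᴴ := by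
  have h1 := Matrix.mul_nonsing_inv _ ((Matrix.isUnit_iff_isUnit_det _).1 h)
  have h2 := Matrix.nonsing_inv_mul _ ((Matrix.isUnit_iff_isUnit_det _).1 h)
  set D := Mm - Mp with hD
  have hMm : Mm = D + Mp := by rw [hD]; abel
  have hω : omega Mp Mm = D⁻¹ := rfl
  have key : fromRows (1 : Matrix (Fin m) (Fin m) ℂ) Mp * D⁻¹ *
        (fromCols (1 : Matrix (Fin m) (Fin m) ℂ) Mm) -
      fromRows (1 : Matrix (Fin m) (Fin m) ℂ) Mm * D⁻¹ *
        (fromCols (1 : Matrix (Fin m) (Fin m) ℂ) Mp) = J m := by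
    rw [fromRows_mul _ Mp, fromRows_mul_fromCols, fromRows_mul, fromRows_mul_fromCols,
      sub_eq_add_neg, fromBlocks_neg, fromBlocks_add, J, hMm]
    simp only [Matrix.one_mul, Matrix.mul_one, Matrix.add_mul, Matrix.mul_add, h1, h2,
      Matrix.mul_assoc]
    congr 1 <;> abel
  rw [← key, hω]
  simp only [weylSolution_eq, conjTranspose_mul, conjTranspose_fromRows_eq_fromCols_conjTranspose,
    conjTranspose_conjTranspose, conjTranspose_one, Matrix.mul_sub, Matrix.sub_mul,
    Matrix.mul_assoc]

/-- The diagonal case of `K` belongs to `U_+` in the upper rows and to `U_-` in the lower ones,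
hence `≤` here and `<` in `greenMatrix_inr`. -/
theorem greenMatrix_inl (H : HamiltonianSystem m) (z : ℂ) (k₀ : ℤ)
    (α : Matrix (Fin m) (Fin m ⊕ Fin m) ℂ) (Mp Mm : Matrix (Fin m) (Fin m) ℂ) (k ℓ : ℤ)
    (i : Fin m) :
    H.greenMatrix z k₀ α Mp Mm k ℓ (Sum.inl i) = if ℓ ≤ k then
      (H.weylSolution z k₀ α Mp k * omega Mp Mm *
        (H.weylSolution (star z) k₀ α Mmᴴ ℓ)ᴴ) (Sum.inl i)
      else (H.weylSolution z k₀ α Mm k * omega Mp Mm *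
        (H.weylSolution (star z) k₀ α Mpᴴ ℓ)ᴴ) (Sum.inl i) := by
  rcases lt_trichotomy ℓ k with h | h | h
  · simp only [greenMatrix, if_pos h, if_pos h.le]
  · subst h
    simp only [greenMatrix, lt_irrefl, if_false, le_refl, if_true]
    funext j
    rcases j with j | j <;> rfl
  · simp only [greenMatrix, if_neg h.asymm, if_pos h, if_neg h.not_ge]

theorem greenMatrix_inr (H : HamiltonianSystem m) (z : ℂ) (k₀ : ℤ)
    (α : Matrix (Fin m) (Fin m ⊕ Fin m) ℂ) (Mp Mm : Matrix (Fin m) (Fin m) ℂ) (k ℓ : ℤ)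
    (i : Fin m) :
    H.greenMatrix z k₀ α Mp Mm k ℓ (Sum.inr i) = if ℓ < k then
      (H.weylSolution z k₀ α Mp k * omega Mp Mm *
        (H.weylSolution (star z) k₀ α Mmᴴ ℓ)ᴴ) (Sum.inr i)
      else (H.weylSolution z k₀ α Mm k * omega Mp Mm *
        (H.weylSolution (star z) k₀ α Mpᴴ ℓ)ᴴ) (Sum.inr i) := by
  rcases lt_trichotomy ℓ k with h | h | h
  · simp only [greenMatrix, if_pos h]
  · subst h
    simp only [greenMatrix, lt_irrefl, if_false]
    funext j
    rcases j with j | j <;> rfl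
  · simp only [greenMatrix, if_neg h.asymm, if_pos h]

/-- The lower component is read at `k + 1`, where its condition `ℓ < k + 1` agrees with `ℓ ≤ k`. In
hat variables both components therefore switch together, with no exceptional diagonal. -/
theorem hatVec_greenMatrix_of_le (H : HamiltonianSystem m) (z : ℂ) (k₀ : ℤ)
    (α : Matrix (Fin m) (Fin m ⊕ Fin m) ℂ) (Mp Mm : Matrix (Fin m) (Fin m) ℂ) {k ℓ : ℤ}
    (h : ℓ ≤ k) (g : Fin m ⊕ Fin m → ℂ) :
    hatVec (fun j => H.greenMatrix z k₀ α Mp Mm j ℓ *ᵥ g) k =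
      hatVec (fun j => H.weylSolution z k₀ α Mp j *ᵥ
        (omega Mp Mm *ᵥ ((H.weylSolution (star z) k₀ α Mmᴴ ℓ)ᴴ *ᵥ g))) k := by
  simp only [mulVec_mulVec, ← Matrix.mul_assoc]
  funext i
  rcases i with i | i
  · exact congrArg (· ⬝ᵥ g) ((H.greenMatrix_inl z k₀ α Mp Mm k ℓ i).trans (if_pos h))
  · exact congrArg (· ⬝ᵥ g) ((H.greenMatrix_inr z k₀ α Mp Mm (k + 1) ℓ i).trans
      (if_pos (by omega)))

theorem hatVec_greenMatrix_of_lt (H : HamiltonianSystem m) (z : ℂ) (k₀ : ℤ)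
    (α : Matrix (Fin m) (Fin m ⊕ Fin m) ℂ) (Mp Mm : Matrix (Fin m) (Fin m) ℂ) {k ℓ : ℤ}
    (h : k < ℓ) (g : Fin m ⊕ Fin m → ℂ) :
    hatVec (fun j => H.greenMatrix z k₀ α Mp Mm j ℓ *ᵥ g) k =
      hatVec (fun j => H.weylSolution z k₀ α Mm j *ᵥ
        (omega Mp Mm *ᵥ ((H.weylSolution (star z) k₀ α Mpᴴ ℓ)ᴴ *ᵥ g))) k := by
  simp only [mulVec_mulVec, ← Matrix.mul_assoc]
  funext i
  rcases i with i | i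
  · exact congrArg (· ⬝ᵥ g) ((H.greenMatrix_inl z k₀ α Mp Mm k ℓ i).trans (if_neg h.not_ge))
  · exact congrArg (· ⬝ᵥ g) ((H.greenMatrix_inr z k₀ α Mp Mm (k + 1) ℓ i).trans
      (if_neg (by omega)))

/-- The action of the system on a sequence that is glued from two solutions. -/
theorem diffExpr_of_hatVec_eq {z : ℂ} {y u v : ℤ → Fin m ⊕ Fin m → ℂ} (hu : H.IsSolution z u)
    (hv : H.IsSolution z v) {k : ℤ} (hyu : hatVec y k = hatVec u k)
    (hyv : hatVec y (k - 1) = hatVec v (k - 1)) :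
    H.diffExpr y k = H.coeff z k *ᵥ y k +
      fromBlocks 0 (H.coeff z k).toBlocks₁₂ (-(H.coeff z k).toBlocks₂₁) 0 *ᵥ (u k - v k) := by
  have hsplit (w : ℤ → Fin m ⊕ Fin m → ℂ) : H.diffExpr w k =
      Sum.elim (H.ρ k *ᵥ (hatVec w k ∘ Sum.inr)) (H.ρ (k - 1) *ᵥ (hatVec w (k - 1) ∘ Sum.inl)) :=
    rfl
  have hinr (w : ℤ → Fin m ⊕ Fin m → ℂ) (i : Fin m) :
      w k (Sum.inr i) = hatVec w (k - 1) (Sum.inr i) := by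
    simp [hatVec]
  have e1 : H.ρ k *ᵥ (hatVec y k ∘ Sum.inr) = (H.coeff z k *ᵥ u k) ∘ Sum.inl := by
    rw [hyu, ← hu k]
    rfl
  have e2 : H.ρ (k - 1) *ᵥ (hatVec y (k - 1) ∘ Sum.inl) = (H.coeff z k *ᵥ v k) ∘ Sum.inr := by
    rw [hyv, ← hv k]
    rfl
  -- At the gluing site `y` has the first component of `u` and the second of `v`. The mismatched
  -- components are what the antidiagonal correction records.
  have y1 : y k ∘ Sum.inl = u k ∘ Sum.inl := by
    funext i
    exact congrFun hyu (Sum.inl i)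
  have y2 : y k ∘ Sum.inr = v k ∘ Sum.inr := by
    funext i
    exact (hinr y i).trans ((congrFun hyv _).trans (hinr v i).symm)
  rw [hsplit, e1, e2]
  conv_lhs => rw [← fromBlocks_toBlocks (H.coeff z k)]
  conv_rhs => enter [1]; rw [← fromBlocks_toBlocks (H.coeff z k)]
  simp only [fromBlocks_mulVec, Sum.elim_comp_inl, Sum.elim_comp_inr, y1, y2, mulVec_sub,
    zero_mulVec, neg_mulVec, add_zero, zero_add]
  funext i
  rcases i with i | i <;> simp only [Sum.elim_inl, Sum.elim_inr, Pi.add_apply, Pi.sub_apply,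
    Pi.neg_apply] <;> ring

/-- Off the diagonal, both hats entering the equation come from one solution. At `ℓ = k` they come
from `U_+` and `U_-`, and the defect is the jump identity applied to `g`. -/
theorem diffExpr_greenMatrix (hH : H.IsAdmissible) (z : ℂ) (k₀ : ℤ)
    {α : Matrix (Fin m) (Fin m ⊕ Fin m) ℂ} (hα : IsBoundaryData α)
    {Mp Mm : Matrix (Fin m) (Fin m) ℂ} (h : IsUnit (Mm - Mp)) (k ℓ : ℤ)
    (g : Fin m ⊕ Fin m → ℂ) :
    H.diffExpr (fun j => H.greenMatrix z k₀ α Mp Mm j ℓ *ᵥ g) k =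
      H.coeff z k *ᵥ (H.greenMatrix z k₀ α Mp Mm k ℓ *ᵥ g) + if ℓ = k then g else 0 := by
  have hp := isSolution_weylSolution_mulVec hH z k₀ α Mp
    (omega Mp Mm *ᵥ ((H.weylSolution (star z) k₀ α Mmᴴ ℓ)ᴴ *ᵥ g))
  have hm := isSolution_weylSolution_mulVec hH z k₀ α Mm
    (omega Mp Mm *ᵥ ((H.weylSolution (star z) k₀ α Mpᴴ ℓ)ᴴ *ᵥ g))
  rcases lt_trichotomy ℓ k with hlt | heq | hgt
  · rw [diffExpr_of_hatVec_eq hp hp (hatVec_greenMatrix_of_le H z k₀ α Mp Mm hlt.le g)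
      (hatVec_greenMatrix_of_le H z k₀ α Mp Mm (by omega) g), sub_self, mulVec_zero,
      if_neg hlt.ne]
  · rw [diffExpr_of_hatVec_eq hp hm (hatVec_greenMatrix_of_le H z k₀ α Mp Mm heq.le g)
      (hatVec_greenMatrix_of_lt H z k₀ α Mp Mm (by omega) g), if_pos heq]
    subst heq
    simp only [mulVec_mulVec, ← Matrix.mul_assoc]
    rw [← sub_mulVec, weylSolution_omega_sub h, mulVec_mulVec, fundamental_jump hH z k₀ hα,
      one_mulVec]
  · rw [diffExpr_of_hatVec_eq hm hm (hatVec_greenMatrix_of_lt H z k₀ α Mp Mm hgt g)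
      (hatVec_greenMatrix_of_lt H z k₀ α Mp Mm (by omega) g), sub_self, mulVec_zero,
      if_neg hgt.ne']

theorem hasSum_mulVec {ι p q : Type*} [Fintype q] (P : Matrix p q ℂ) {g : ι → q → ℂ} {a : q → ℂ}
    (h : HasSum g a) : HasSum (fun i => P *ᵥ g i) (P *ᵥ a) :=
  h.map P.mulVecLin (continuous_const.matrix_mulVec continuous_id)

theorem diffExpr_eq_mulVec (H : HamiltonianSystem m) (y : ℤ → Fin m ⊕ Fin m → ℂ) (k : ℤ) :
    H.diffExpr y k =
      fromBlocks 0 (H.ρ k) 0 0 *ᵥ y (k + 1) + fromBlocks 0 0 (H.ρ (k - 1)) 0 *ᵥ y (k - 1) := by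
  simp only [fromBlocks_mulVec, zero_mulVec, zero_add, add_zero, diffExpr]
  funext i
  rcases i with i | i
  · exact (add_zero _).symm
  · exact (zero_add _).symm

/-- Sums of Green's matrix against a sequence solve the nonhomogeneous system. -/
theorem diffExpr_of_hasSum (hH : H.IsAdmissible) (z : ℂ) (k₀ : ℤ)
    {α : Matrix (Fin m) (Fin m ⊕ Fin m) ℂ} (hα : IsBoundaryData α)
    {Mp Mm : Matrix (Fin m) (Fin m) ℂ} (h : IsUnit (Mm - Mp)) {g y : ℤ → Fin m ⊕ Fin m → ℂ}
    (hy : ∀ k, HasSum (fun ℓ => H.greenMatrix z k₀ α Mp Mm k ℓ *ᵥ g ℓ) (y k)) (k : ℤ) :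
    H.diffExpr y k = H.coeff z k *ᵥ y k + g k := by
  have h1 : HasSum (fun ℓ => H.diffExpr (fun j => H.greenMatrix z k₀ α Mp Mm j ℓ *ᵥ g ℓ) k)
      (H.diffExpr y k) := by
    simp only [diffExpr_eq_mulVec]
    exact (hasSum_mulVec _ (hy (k + 1))).add (hasSum_mulVec _ (hy (k - 1)))
  simp only [diffExpr_greenMatrix hH z k₀ hα h] at h1
  refine h1.unique ((hasSum_mulVec _ (hy k)).add ?_)
  simpa using hasSum_single (f := fun ℓ => if ℓ = k then g ℓ else 0) k fun ℓ hℓ => if_neg hℓ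

/-! ### Convergence of the Green series -/

/-- As a function of `ℓ` this is a Weyl solution at `z̄`, built from `M_+^*` right of `k` and
`M_-^*` left of it; hence the need for the reflected disks. -/
theorem memL2A_greenMatrix_row (hH : H.IsAdmissible) {z : ℂ} (hz : z.im ≠ 0) {k₀ : ℤ}
    {α : Matrix (Fin m) (Fin m ⊕ Fin m) ℂ} (hα : IsBoundaryData α)
    {Mp Mm : Matrix (Fin m) (Fin m) ℂ} (hMp : Mp ∈ H.limitingDiskPlus z k₀ α)
    (hMm : Mm ∈ H.limitingDiskMinus z k₀ α) (k : ℤ) (v : Fin m ⊕ Fin m → ℂ) :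
    H.MemL2A fun ℓ => (H.greenMatrix z k₀ α Mp Mm k ℓ)ᴴ *ᵥ v := by
  refine memL2A_of_eq_weylSolution hH (z := star z) (by simpa using hz)
    ((limitingDiskPlus_star hH hz hα Mp).2 hMp) ((limitingDiskMinus_star hH hz hα Mm).2 hMm)
    (k := k) (v := (H.weylSolution z k₀ α Mm k * omega Mp Mm)ᴴ *ᵥ v)
    (w := (H.weylSolution z k₀ α Mp k * omega Mp Mm)ᴴ *ᵥ v) (fun ℓ hℓ => ?_) fun ℓ hℓ => ?_
  · simp only [greenMatrix, if_neg hℓ.asymm, if_pos hℓ]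
    rw [conjTranspose_mul, conjTranspose_conjTranspose, mulVec_mulVec]
  · simp only [greenMatrix, if_pos hℓ]
    rw [conjTranspose_mul, conjTranspose_conjTranspose, mulVec_mulVec]

theorem summable_greenMatrix_mulVec (hH : H.IsAdmissible) {z : ℂ} (hz : z.im ≠ 0) {k₀ : ℤ}
    {α : Matrix (Fin m) (Fin m ⊕ Fin m) ℂ} (hα : IsBoundaryData α)
    {Mp Mm : Matrix (Fin m) (Fin m) ℂ} (hMp : Mp ∈ H.limitingDiskPlus z k₀ α)
    (hMm : Mm ∈ H.limitingDiskMinus z k₀ α) {f : ℤ → Fin m ⊕ Fin m → ℂ} (hf : H.MemL2A f)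
    (k : ℤ) : Summable fun ℓ => (H.greenMatrix z k₀ α Mp Mm k ℓ * H.A ℓ) *ᵥ f ℓ := by
  refine Pi.summable.2 fun i => ?_
  refine ((memL2A_greenMatrix_row hH hz hα hMp hMm k (Pi.single i 1)).summable_dotProduct hH
    hf).congr fun ℓ => ?_
  rw [star_mulVec, conjTranspose_conjTranspose, ← dotProduct_mulVec, mulVec_mulVec,
    ← Pi.single_star, star_one, single_one_dotProduct]

/-- Column `j` is the Green series applied to the square summable sequence `K(z,k,ℓ)^* e_j`. -/
theorem summable_greenMatrix_mul_mul (hH : H.IsAdmissible) {z : ℂ} (hz : z.im ≠ 0) {k₀ : ℤ}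
    {α : Matrix (Fin m) (Fin m ⊕ Fin m) ℂ} (hα : IsBoundaryData α)
    {Mp Mm : Matrix (Fin m) (Fin m) ℂ} (hMp : Mp ∈ H.limitingDiskPlus z k₀ α)
    (hMm : Mm ∈ H.limitingDiskMinus z k₀ α) (k : ℤ) :
    Summable fun ℓ : ℤ => H.greenMatrix z k₀ α Mp Mm k ℓ * H.A ℓ *
      (H.greenMatrix z k₀ α Mp Mm k ℓ)ᴴ := by
  refine Pi.summable.2 fun i => Pi.summable.2 fun j => ?_
  refine (Pi.summable.1 (summable_greenMatrix_mulVec hH hz hα hMp hMm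
    (memL2A_greenMatrix_row hH hz hα hMp hMm k (Pi.single j 1)) k) i).congr fun ℓ => ?_
  rw [mulVec_mulVec, mulVec_single_one]
  rfl

/-! ### The norm bound -/

/-- The a priori bound for truncated right-hand sides. -/
theorem sum_density_truncated_le (hH : H.IsAdmissible) {z : ℂ} (hz : 0 < z.im) {k₀ : ℤ}
    {α : Matrix (Fin m) (Fin m ⊕ Fin m) ℂ} (hα : IsBoundaryData α)
    {Mp Mm : Matrix (Fin m) (Fin m) ℂ} (hMp : Mp ∈ H.limitingDiskPlus z k₀ α)
    (hMm : Mm ∈ H.limitingDiskMinus z k₀ α) {f : ℤ → Fin m ⊕ Fin m → ℂ} (hf : H.MemL2A f)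
    (F u : Finset ℤ) :
    z.im ^ 2 * ∑ k ∈ u, H.density
      (fun k => ∑ ℓ ∈ F, (H.greenMatrix z k₀ α Mp Mm k ℓ * H.A ℓ) *ᵥ f ℓ) k ≤
      ∑' k, H.density f k := by
  classical
  set y : ℤ → Fin m ⊕ Fin m → ℂ :=
    fun k => ∑ ℓ ∈ F, (H.greenMatrix z k₀ α Mp Mm k ℓ * H.A ℓ) *ᵥ f ℓ with hy
  let fF : ℤ → Fin m ⊕ Fin m → ℂ := fun ℓ => if ℓ ∈ F then f ℓ else 0
  have hsum (k : ℤ) :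
      HasSum (fun ℓ => H.greenMatrix z k₀ α Mp Mm k ℓ *ᵥ (H.A ℓ *ᵥ fF ℓ)) (y k) := by
    have e : y k = ∑ ℓ ∈ F, H.greenMatrix z k₀ α Mp Mm k ℓ *ᵥ (H.A ℓ *ᵥ fF ℓ) :=
      Finset.sum_congr rfl fun ℓ hℓ => by rw [mulVec_mulVec]; simp only [fF, if_pos hℓ]
    rw [e]
    refine hasSum_sum_of_ne_finset_zero fun ℓ hℓ => ?_
    simp only [fF, if_neg hℓ, mulVec_zero]
  have hsol (k : ℤ) : H.diffExpr y k = H.coeff z k *ᵥ y k + H.A k *ᵥ fF k :=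
    diffExpr_of_hasSum hH z k₀ hα (isUnit_sub hH hz.ne' hα hMp hMm) hsum k
  have hhat (k : ℤ) : hatVec y k =
      ∑ ℓ ∈ F, hatVec (fun j => H.greenMatrix z k₀ α Mp Mm j ℓ *ᵥ (H.A ℓ *ᵥ f ℓ)) k := by
    funext i
    rcases i with i | i <;> simp only [hatVec, hy, Sum.elim_inl, Sum.elim_inr, Finset.sum_apply,
      mulVec_mulVec]
  -- The window `(a, b]` contains `F ∪ u` and `k₀`, so at its ends `ŷ` lies in the range of `Û_-`
  -- and `Û_+` respectively.
  obtain ⟨a, ha, hka⟩ : ∃ a : ℤ, (∀ k ∈ F ∪ u, a < k) ∧ a < k₀ := by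
    obtain ⟨a, ha⟩ := (F ∪ u).bddBelow
    exact ⟨min (a - 1) (k₀ - 1), fun k hk => by have := ha hk; omega, by omega⟩
  obtain ⟨b, hb, hkb⟩ : ∃ b : ℤ, (∀ k ∈ F ∪ u, k ≤ b) ∧ k₀ < b := by
    obtain ⟨b, hb⟩ := (F ∪ u).bddAbove
    exact ⟨max b (k₀ + 1), fun k hk => (hb hk).trans (le_max_left _ _), by omega⟩
  have hbr_b : (H.bracket b (hatVec y b) (hatVec y b)).im ≤ 0 := by
    obtain ⟨c, e⟩ : ∃ c, hatVec y b = hat (H.weylSolution z k₀ α Mp) b *ᵥ c := by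
      refine ⟨∑ ℓ ∈ F, (omega Mp Mm *ᵥ
        ((H.weylSolution (star z) k₀ α Mmᴴ ℓ)ᴴ *ᵥ (H.A ℓ *ᵥ f ℓ))), ?_⟩
      rw [hhat, mulVec_sum]
      refine Finset.sum_congr rfl fun ℓ hℓ => ?_
      rw [hatVec_greenMatrix_of_le H z k₀ α Mp Mm (hb ℓ (Finset.mem_union_left _ hℓ)), hat_mulVec]
    have h1 := (mem_weylDisk_iff hH z k₀ α b Mp).1 (Set.mem_iInter₂.1 hMp b hkb) c
    rw [← e] at h1
    have h2 := σ_mul_im_of_lt hkb z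
    rw [abs_of_pos hz, mul_eq_right₀ hz.ne'] at h2
    rwa [h2, one_mul] at h1
  have hbr_a : 0 ≤ (H.bracket a (hatVec y a) (hatVec y a)).im := by
    obtain ⟨c, e⟩ : ∃ c, hatVec y a = hat (H.weylSolution z k₀ α Mm) a *ᵥ c := by
      refine ⟨∑ ℓ ∈ F, (omega Mp Mm *ᵥ
        ((H.weylSolution (star z) k₀ α Mpᴴ ℓ)ᴴ *ᵥ (H.A ℓ *ᵥ f ℓ))), ?_⟩
      rw [hhat, mulVec_sum]
      refine Finset.sum_congr rfl fun ℓ hℓ => ?_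
      rw [hatVec_greenMatrix_of_lt H z k₀ α Mp Mm (ha ℓ (Finset.mem_union_left _ hℓ)), hat_mulVec]
    have h1 := (mem_weylDisk_iff hH z k₀ α a Mm).1 (Set.mem_iInter₂.1 hMm a hka) c
    rw [← e] at h1
    have h2 := σ_mul_im_of_gt hka z
    rw [abs_of_pos hz, ← neg_one_mul z.im, mul_left_inj' hz.ne'] at h2
    rw [h2] at h1
    linarith
  have htele := sum_Ioc_sub_sub_one
    (fun k => (H.bracket k (hatVec y k) (hatVec y k)).im) (hka.trans hkb).le
  simp only [im_bracket_sub hH (hsol _)] at htele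
  -- Completing the square with `t = Im z`, `c = -i` absorbs the source into half of `2 (Im z)²`
  -- times the density. After summation the first bracket on the right telescopes to a nonpositive
  -- quantity.
  have hterm (k : ℤ) : 2 * z.im ^ 2 * H.density y k ≤
      z.im * (2 * z.im * H.density y k + 2 * (star (y k) ⬝ᵥ (H.A k *ᵥ fF k)).im) +
        (z.im ^ 2 * H.density y k + H.density f k) := by
    have h1 := two_mul_re_le_density hH y fF k z.im (c := -Complex.I) (by simp)
    have h2 : H.density fF k ≤ H.density f k := by
      by_cases hk : k ∈ F
      · simp only [density, fF, if_pos hk, le_refl]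
      · have h3 := density_nonneg hH f k
        simpa [density, fF, if_neg hk] using h3
    have h3 (w : ℂ) : (-Complex.I * w).re = w.im := by simp
    rw [h3] at h1
    linarith
  have hIoc := Finset.sum_le_sum fun k (_ : k ∈ Finset.Ioc a b) => hterm k
  rw [Finset.sum_add_distrib, Finset.sum_add_distrib, ← Finset.mul_sum, ← Finset.mul_sum,
    ← Finset.mul_sum, htele] at hIoc
  have hfsum : ∑ k ∈ Finset.Ioc a b, H.density f k ≤ ∑' k, H.density f k :=
    hf.sum_le_tsum _ fun k _ => density_nonneg hH f k
  have hu : ∑ k ∈ u, H.density y k ≤ ∑ k ∈ Finset.Ioc a b, H.density y k :=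
    Finset.sum_le_sum_of_subset_of_nonneg (fun k hk => Finset.mem_Ioc.2
      ⟨ha k (Finset.mem_union_right _ hk), hb k (Finset.mem_union_right _ hk)⟩)
      fun k _ _ => density_nonneg hH y k
  have hu' := mul_le_mul_of_nonneg_left hu (sq_nonneg z.im)
  have hbr := mul_nonneg hz.le (sub_nonneg.2 (hbr_b.trans hbr_a))
  linarith

/-- The truncated bound is uniform in `F`, and a density sum over the fixed finite set `u` is
continuous in finitely many values of `y`, so `F` can exhaust `ℤ`. -/
theorem sum_density_greenSolution_le (hH : H.IsAdmissible) {z : ℂ} (hz : 0 < z.im) {k₀ : ℤ}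
    {α : Matrix (Fin m) (Fin m ⊕ Fin m) ℂ} (hα : IsBoundaryData α)
    {Mp Mm : Matrix (Fin m) (Fin m) ℂ} (hMp : Mp ∈ H.limitingDiskPlus z k₀ α)
    (hMm : Mm ∈ H.limitingDiskMinus z k₀ α) {f : ℤ → Fin m ⊕ Fin m → ℂ} (hf : H.MemL2A f)
    (u : Finset ℤ) :
    ∑ k ∈ u, H.density (H.greenSolution z k₀ α Mp Mm f) k ≤
      (∑' k, H.density f k) / z.im ^ 2 := by
  have hlim : Filter.Tendsto (fun F : Finset ℤ => ∑ k ∈ u, H.density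
      (fun k => ∑ ℓ ∈ F, (H.greenMatrix z k₀ α Mp Mm k ℓ * H.A ℓ) *ᵥ f ℓ) k) Filter.atTop
      (𝓝 (∑ k ∈ u, H.density (H.greenSolution z k₀ α Mp Mm f) k)) := by
    refine tendsto_finsetSum _ fun k _ => ?_
    have hcont : Continuous fun x : Fin m ⊕ Fin m → ℂ => (star x ⬝ᵥ (H.A k *ᵥ x)).re :=
      Complex.continuous_re.comp (continuous_star.dotProduct
        (continuous_const.matrix_mulVec continuous_id))
    exact (hcont.tendsto _).comp
      (summable_greenMatrix_mulVec hH hz.ne' hα hMp hMm hf k).hasSum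
  refine le_of_tendsto' hlim fun F => ?_
  rw [le_div_iff₀' (by positivity)]
  exact sum_density_truncated_le hH hz hα hMp hMm hf F u

theorem memL2A_greenSolution (hH : H.IsAdmissible) {z : ℂ} (hz : 0 < z.im) {k₀ : ℤ}
    {α : Matrix (Fin m) (Fin m ⊕ Fin m) ℂ} (hα : IsBoundaryData α)
    {Mp Mm : Matrix (Fin m) (Fin m) ℂ} (hMp : Mp ∈ H.limitingDiskPlus z k₀ α)
    (hMm : Mm ∈ H.limitingDiskMinus z k₀ α) {f : ℤ → Fin m ⊕ Fin m → ℂ} (hf : H.MemL2A f) :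
    H.MemL2A (H.greenSolution z k₀ α Mp Mm f) :=
  summable_of_sum_le (density_nonneg hH _) (sum_density_greenSolution_le hH hz hα hMp hMm hf)

theorem normA_greenSolution_le (hH : H.IsAdmissible) {z : ℂ} (hz : 0 < z.im) {k₀ : ℤ}
    {α : Matrix (Fin m) (Fin m ⊕ Fin m) ℂ} (hα : IsBoundaryData α)
    {Mp Mm : Matrix (Fin m) (Fin m) ℂ} (hMp : Mp ∈ H.limitingDiskPlus z k₀ α)
    (hMm : Mm ∈ H.limitingDiskMinus z k₀ α) {f : ℤ → Fin m ⊕ Fin m → ℂ} (hf : H.MemL2A f) :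
    H.normA (H.greenSolution z k₀ α Mp Mm f) ≤ |z.im|⁻¹ * H.normA f := by
  have h := (memL2A_greenSolution hH hz hα hMp hMm hf).tsum_le_of_sum_le
    (sum_density_greenSolution_le hH hz hα hMp hMm hf)
  rw [normA, normA, abs_of_pos hz, inv_mul_eq_div]
  refine (Real.sqrt_le_sqrt h).trans_eq ?_
  rw [Real.sqrt_div' _ (sq_nonneg _), Real.sqrt_sq hz.le]

theorem diffExpr_greenSolution (hH : H.IsAdmissible) {z : ℂ} (hz : z.im ≠ 0) {k₀ : ℤ}
    {α : Matrix (Fin m) (Fin m ⊕ Fin m) ℂ} (hα : IsBoundaryData α)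
    {Mp Mm : Matrix (Fin m) (Fin m) ℂ} (hMp : Mp ∈ H.limitingDiskPlus z k₀ α)
    (hMm : Mm ∈ H.limitingDiskMinus z k₀ α) {f : ℤ → Fin m ⊕ Fin m → ℂ} (hf : H.MemL2A f)
    (k : ℤ) :
    H.diffExpr (H.greenSolution z k₀ α Mp Mm f) k =
      H.coeff z k *ᵥ H.greenSolution z k₀ α Mp Mm f k + H.A k *ᵥ f k := by
  refine diffExpr_of_hasSum hH z k₀ hα (isUnit_sub hH hz hα hMp hMm)
    (g := fun ℓ => H.A ℓ *ᵥ f ℓ) (fun k => ?_) k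
  simp only [mulVec_mulVec]
  exact (summable_greenMatrix_mulVec hH hz hα hMp hMm hf k).hasSum

end HamiltonianSystem

theorem mainTheorem1 (m : ℕ) (hm : 1 ≤ m) (H : HamiltonianSystem m) (hH : H.IsAdmissible)
    (k₀ : ℤ) (α : Matrix (Fin m) (Fin m ⊕ Fin m) ℂ) (hα : HamiltonianSystem.IsBoundaryData α)
    (z : ℂ) (hz : 0 < z.im)
    (hplus : HamiltonianSystem.IsLimitPoint (H.limitingDiskPlus z k₀ α) ∨
      HamiltonianSystem.IsLimitCircle (H.limitingDiskPlus z k₀ α))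
    (hminus : HamiltonianSystem.IsLimitPoint (H.limitingDiskMinus z k₀ α) ∨
      HamiltonianSystem.IsLimitCircle (H.limitingDiskMinus z k₀ α))
    (Mp Mm : Matrix (Fin m) (Fin m) ℂ)
    (hMp : Mp ∈ frontier (H.limitingDiskPlus z k₀ α))
    (hMm : Mm ∈ frontier (H.limitingDiskMinus z k₀ α)) :
    -- the data at `z̄` and the matrix `ω(z)` are well defined
    (Mpᴴ ∈ frontier (H.limitingDiskPlus (star z) k₀ α) ∧
      Mmᴴ ∈ frontier (H.limitingDiskMinus (star z) k₀ α)) ∧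
    (IsUnit (Mm - Mp) ∧
      HamiltonianSystem.omega Mp Mm =
        ((HamiltonianSystem.hat (H.weylSolution (star z) k₀ α Mmᴴ) k₀)ᴴ * H.Jρ k₀ *
          HamiltonianSystem.hat (H.weylSolution z k₀ α Mp) k₀)⁻¹ ∧
      HamiltonianSystem.omega Mp Mm =
        -((HamiltonianSystem.hat (H.weylSolution (star z) k₀ α Mpᴴ) k₀)ᴴ * H.Jρ k₀ *
          HamiltonianSystem.hat (H.weylSolution z k₀ α Mm) k₀)⁻¹) ∧
    -- `∑ K A K^* < ∞`
    (∀ k : ℤ, Summable fun ℓ : ℤ =>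
      H.greenMatrix z k₀ α Mp Mm k ℓ * H.A ℓ * (H.greenMatrix z k₀ α Mp Mm k ℓ)ᴴ) ∧
    -- the solution of the nonhomogeneous system
    (∀ f : ℤ → Fin m ⊕ Fin m → ℂ, H.MemL2A f →
      (∀ k : ℤ, Summable fun ℓ : ℤ => (H.greenMatrix z k₀ α Mp Mm k ℓ * H.A ℓ) *ᵥ f ℓ) ∧
      (∀ k : ℤ, H.diffExpr (H.greenSolution z k₀ α Mp Mm f) k =
        H.coeff z k *ᵥ H.greenSolution z k₀ α Mp Mm f k + H.A k *ᵥ f k) ∧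
      H.MemL2A (H.greenSolution z k₀ α Mp Mm f) ∧
      H.normA (H.greenSolution z k₀ α Mp Mm f) ≤ |z.im|⁻¹ * H.normA f) := by
  have hMp' := (HamiltonianSystem.isClosed_limitingDiskPlus hH z k₀ α).frontier_subset hMp
  have hMm' := (HamiltonianSystem.isClosed_limitingDiskMinus hH z k₀ α).frontier_subset hMm
  have hU := HamiltonianSystem.isUnit_sub hH hz.ne' hα hMp' hMm'
  exact ⟨⟨HamiltonianSystem.conjTranspose_mem_frontier
      (HamiltonianSystem.limitingDiskPlus_star hH hz.ne' hα) hMp,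
    HamiltonianSystem.conjTranspose_mem_frontier
      (HamiltonianSystem.limitingDiskMinus_star hH hz.ne' hα) hMm⟩,
    ⟨hU, HamiltonianSystem.omega_eq_inv_gram hH z k₀ hα Mp Mm k₀,
      HamiltonianSystem.omega_eq_neg_inv_gram hH z k₀ hα hU k₀⟩,
    HamiltonianSystem.summable_greenMatrix_mul_mul hH hz.ne' hα hMp' hMm',
    fun f hf => ⟨HamiltonianSystem.summable_greenMatrix_mulVec hH hz.ne' hα hMp' hMm' hf,
      HamiltonianSystem.diffExpr_greenSolution hH hz.ne' hα hMp' hMm' hf,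
      HamiltonianSystem.memL2A_greenSolution hH hz hα hMp' hMm' hf,
      HamiltonianSystem.normA_greenSolution_le hH hz hα hMp' hMm' hf⟩⟩
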